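/- An order in a number field $K$ is a subring $\mathcal{O}\subseteq K$ that is finitely generated as a $\mathbb{Z}$-module and contains a $\mathbb{Q}$-basis of $K$. For a maximal ideal $\mathfrak{p}$ of $\mathcal{O}$ let $\operatorname{ord}_\mathfrak{p}\colon K^*\to\mathbb{Z}$ be the homomorphism with $$\operatorname{ord}_\mathfrak{p}(a/b)=\operatorname{len}_{\mathcal{O}_\mathfrak{p}}(\mathcal{O}_\mathfrak{p}/a\mathcal{O}_\mathfrak{p})-\operatorname{len}_{\mathcal{O}_\mathfrak{p}}(\mathcal{O}_\mathfrak{p}/b\mathcal{O}_\mathfrak{p})\qquad(a,b\in\mathcal{O}\setminus\{0\}),$$ where $\operatorname{len}$ denotes the length of a module. The Chow group of $\mathcal{O}$ is the free abelian group on the maximal ideals of $\mathcal{O}$ modulo the subgroup of principal divisors $\sum_{\mathfrak{p}}\operatorname{ord}_\mathfrak{p}(x)\,\mathfrak{p}$, $x\in K^*$. **Theorem 3.8.** There are infinitely many pairwise non-isomorphic quadratic number fields that contain an order with trivial Chow group. More precisely, for an odd prime $p$ put $p^*=(-1)^{(p-1)/2}p$. Then for every odd prime $p$ the field $\mathbb{Q}(\sqrt{p^*})$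 has degree $2$ over $\mathbb{Q}$ and contains an order with trivial Chow group, and for distinct odd primes $p\neq q$ the fields $\mathbb{Q}(\sqrt{p^*})$ and $\mathbb{Q}(\sqrt{q^*})$ are not isomorphic. -/

import Mathlib

open scoped nonZeroDivisors

/-! ### Divisors and the Chow group of a one-dimensional noetherian domain -/

namespace OneDim

section

set_option linter.unusedSectionVars false
set_option linter.style.haveILetI false

variable (R : Type*) [CommRing R] [IsDomain R] [IsNoetherianRing R] [Ring.DimensionLEOne R]
variable (K : Type*) [Field K] [Algebra R K] [IsFractionRing R K]

/-- The localization of `R` at a prime has dimension at most one. -/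
theorem localization_dimensionLEOne (p : Ideal R) [p.IsPrime] :
    Ring.DimensionLEOne (Localization.AtPrime p) :=
  Ring.DimensionLEOne.localization (Localization.AtPrime p) p.primeCompl_le_nonZeroDivisors

/-- The canonical map from the localization `R_p` to the fraction field `K` of `R`. -/
@[reducible] noncomputable def localizationAlgebra (p : Ideal R) [p.IsPrime] :
    Algebra (Localization.AtPrime p) K :=
  IsLocalization.localizationAlgebraOfSubmonoidLe (Localization.AtPrime p) K
    p.primeCompl R⁰ p.primeCompl_le_nonZeroDivisors

theorem localization_isScalarTower (p : Ideal R) [p.IsPrime] :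
    letI := localizationAlgebra R K p
    IsScalarTower R (Localization.AtPrime p) K :=
  IsLocalization.localization_isScalarTower_of_submonoid_le (Localization.AtPrime p) K
    p.primeCompl R⁰ p.primeCompl_le_nonZeroDivisors

/-- `K` is the fraction field of `R_p`. -/
theorem localization_isFractionRing (p : Ideal R) [p.IsPrime] :
    letI := localizationAlgebra R K p
    IsFractionRing (Localization.AtPrime p) K :=
  letI := localizationAlgebra R K p
  haveI := localization_isScalarTower R K p
  IsFractionRing.isFractionRing_of_isDomain_of_isLocalization p.primeCompl _ _

/-- The order homomorphism at `p` on the fraction field, with values in `ℤ` written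
multiplicatively with an added zero (the value of `0`): Mathlib's order of vanishing of the
local ring `R_p`. -/
noncomputable def ordHom (p : Ideal R) [p.IsPrime] : K →*₀ WithZero (Multiplicative ℤ) :=
  letI := localizationAlgebra R K p
  haveI := localization_isFractionRing R K p
  haveI := localization_dimensionLEOne R p
  Ring.ordFrac (Localization.AtPrime p)

/-- `ord_p : Kˣ → ℤ`, characterized by
`ord_p (a / b) = length (R_p / a R_p) - length (R_p / b R_p)` (see `ord_div`). -/
noncomputable def ord (p : Ideal R) [p.IsPrime] : Additive Kˣ →+ ℤ :=
  MonoidHom.toAdditiveLeft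
    ((WithZero.unitsWithZeroEquiv (α := Multiplicative ℤ)).toMonoidHom.comp
      (Units.map (ordHom R K p).toMonoidHom))

variable {R K}

theorem coe_ord (p : Ideal R) [p.IsPrime] (x : Kˣ) :
    WithZero.exp (ord R K p (Additive.ofMul x)) = ordHom R K p x := by
  have h := WithZero.coe_unitsWithZeroEquiv_eq_units_val
    (Units.map (ordHom R K p).toMonoidHom x)
  exact h

theorem ordHom_algebraMap (p : Ideal R) [p.IsPrime] {a : R} (ha : a ≠ 0) :
    ordHom R K p (algebraMap R K a) =
      WithZero.exp ((Module.length (Localization.AtPrime p) (Localization.AtPrime p ⧸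
        Ideal.span {algebraMap R (Localization.AtPrime p) a})).toNat : ℤ) := by
  letI := localizationAlgebra R K p
  haveI := localization_isScalarTower R K p
  haveI := localization_isFractionRing R K p
  haveI := localization_dimensionLEOne R p
  have ha' : algebraMap R (Localization.AtPrime p) a ≠ 0 := by
    rw [Ne, IsLocalization.to_map_eq_zero_iff _ p.primeCompl_le_nonZeroDivisors]
    exact ha
  have hm := mem_nonZeroDivisors_of_ne_zero ha'
  rw [IsScalarTower.algebraMap_apply R (Localization.AtPrime p) K]
  refine (Ring.ordFrac_eq_ord _ ha').trans ?_
  exact Ring.ordMonoidWithZeroHom_eq_coe _ hm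
    (ENat.natCast_toNat (Ring.ord_ne_top hm)).symm

/-- The defining formula of `ord_p`. -/
theorem ord_div (p : Ideal R) [p.IsPrime] (x : Kˣ) {a b : R} (ha : a ≠ 0) (hb : b ≠ 0)
    (hx : (x : K) = algebraMap R K a / algebraMap R K b) :
    ord R K p (Additive.ofMul x) =
      ((Module.length (Localization.AtPrime p) (Localization.AtPrime p ⧸
        Ideal.span {algebraMap R (Localization.AtPrime p) a})).toNat : ℤ) -
      ((Module.length (Localization.AtPrime p) (Localization.AtPrime p ⧸
        Ideal.span {algebraMap R (Localization.AtPrime p) b})).toNat : ℤ) := by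
  apply WithZero.exp_injective
  rw [coe_ord, hx, map_div₀, ordHom_algebraMap p ha, ordHom_algebraMap p hb, WithZero.exp_sub]

/-- A nonzero element lies in only finitely many maximal ideals. -/
theorem finite_maximal_mem {a : R} (ha : a ≠ 0) :
    {p : MaximalSpectrum R | a ∈ p.asIdeal}.Finite := by
  refine Set.Finite.of_finite_image (f := MaximalSpectrum.asIdeal) ?_
    (fun p _ q _ h => MaximalSpectrum.ext h)
  refine (Ideal.finite_minimalPrimes_of_isNoetherianRing R (Ideal.span {a})).subset ?_
  rintro _ ⟨p, hp, rfl⟩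
  refine ⟨⟨p.isMaximal.isPrime, (Ideal.span_singleton_le_iff_mem _).2 hp⟩, ?_⟩
  rintro q ⟨hq, hqa⟩ hqp
  have hq0 : q ≠ ⊥ := by
    rintro rfl
    exact ha (by simpa using hqa)
  exact ((hq.isMaximal hq0).eq_of_le p.isMaximal.ne_top hqp).ge

theorem length_eq_zero_of_notMem (p : Ideal R) [p.IsPrime] {a : R} (ha : a ∉ p) :
    Module.length (Localization.AtPrime p) (Localization.AtPrime p ⧸
        Ideal.span {algebraMap R (Localization.AtPrime p) a}) = 0 := by
  have hu : IsUnit (algebraMap R (Localization.AtPrime p) a) :=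
    IsLocalization.map_units (Localization.AtPrime p) (⟨a, ha⟩ : p.primeCompl)
  exact Ring.ord_of_isUnit hu

theorem finite_ord_ne_zero (x : Additive Kˣ) :
    {p : MaximalSpectrum R | ord R K p.asIdeal x ≠ 0}.Finite := by
  obtain ⟨a, b, hb, hab⟩ := IsFractionRing.div_surjective (A := R) ((x.toMul : Kˣ) : K)
  have hb0 : b ≠ 0 := nonZeroDivisors.ne_zero hb
  have ha0 : a ≠ 0 := by
    rintro rfl
    exact x.toMul.ne_zero (by simpa using hab.symm)
  refine ((finite_maximal_mem ha0).union (finite_maximal_mem hb0)).subset ?_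
  intro p hp
  by_contra hn
  simp only [Set.mem_union, Set.mem_ofPred_eq, not_or] at hn
  apply hp
  have h := ord_div p.asIdeal x.toMul ha0 hb0 hab.symm
  rw [length_eq_zero_of_notMem _ hn.1, length_eq_zero_of_notMem _ hn.2] at h
  simpa using h

variable (R K)

/-- The group of divisors: the free abelian group on the maximal ideals. -/
abbrev Divisors (R : Type*) [CommRing R] : Type _ := MaximalSpectrum R →₀ ℤ

/-- The divisor homomorphism `a ↦ ∑ ord_p(a) p` on `Kˣ`. -/
noncomputable def divHom : Additive Kˣ →+ Divisors R where
  toFun x := Finsupp.ofSupportFinite (fun p => ord R K p.asIdeal x) (finite_ord_ne_zero x)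
  map_zero' := by
    ext p
    exact map_zero (ord R K p.asIdeal)
  map_add' x y := by
    ext p
    exact map_add (ord R K p.asIdeal) x y

variable {R K} in
theorem divHom_apply (x : Additive Kˣ) (p : MaximalSpectrum R) :
    divHom R K x p = ord R K p.asIdeal x := rfl

/-- The Chow group: divisors modulo principal divisors. (The noetherian domain `R` with fraction
field `K` is meant to be one-dimensional, i.e. of dimension at most one and not a field.) -/
abbrev ChowGroup : Type _ := Divisors R ⧸ (divHom R K).range

end

end OneDim

/-! ### Orders in number fields -/

/-- An order in a number field `K`: a subring that is finitely generated as a `ℤ`-module and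
contains a `ℚ`-basis of `K`. -/
structure NumberFieldOrder (K : Type*) [Field K] [CharZero K] where
  toSubring : Subring K
  finite : Module.Finite ℤ toSubring
  span_eq_top : Submodule.span ℚ (toSubring : Set K) = ⊤

namespace NumberFieldOrder

variable {K : Type*} [Field K] [CharZero K] (O : NumberFieldOrder K)

instance : Module.Finite ℤ O.toSubring := O.finite

instance : IsNoetherianRing O.toSubring := IsNoetherianRing.of_finite ℤ O.toSubring

instance : Ring.DimensionLEOne O.toSubring :=
  Ring.DimensionLEOne.of_isIntegral ℤ O.toSubring

/-- Every element of `K` is of the form `a / n` with `a` in the order and `n` a nonzero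
integer. -/
theorem exists_int_mul_mem (x : K) : ∃ n : ℤ, n ≠ 0 ∧ (n : K) * x ∈ O.toSubring := by
  have hx : x ∈ Submodule.span ℚ (O.toSubring : Set K) := by
    rw [O.span_eq_top]
    exact Submodule.mem_top
  induction hx using Submodule.span_induction with
  | mem x h => exact ⟨1, one_ne_zero, by simpa using h⟩
  | zero => exact ⟨1, one_ne_zero, by simp⟩
  | add x y _ _ hx hy =>
    obtain ⟨m, hm, hmx⟩ := hx
    obtain ⟨n, hn, hny⟩ := hy
    refine ⟨m * n, mul_ne_zero hm hn, ?_⟩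
    have h : ((m * n : ℤ) : K) * (x + y) = n * (m * x) + m * (n * y) := by
      push_cast
      ring
    rw [h]
    exact add_mem (mul_mem (intCast_mem _ n) hmx) (mul_mem (intCast_mem _ m) hny)
  | smul q x _ hx =>
    obtain ⟨m, hm, hmx⟩ := hx
    refine ⟨q.den * m, mul_ne_zero (by exact_mod_cast q.den_nz) hm, ?_⟩
    have hq : (q.den : K) * (q : K) = (q.num : K) := by
      rw [Rat.cast_def]
      field_simp [(Nat.cast_ne_zero.2 q.den_nz : (q.den : K) ≠ 0)]
    have h : ((q.den * m : ℤ) : K) * (q • x) = q.num * (m * x) := by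
      rw [Rat.smul_def, ← hq]
      push_cast
      ring
    rw [h]
    exact mul_mem (intCast_mem _ _) hmx

/-- `K` is the field of fractions of each of its orders. -/
instance : IsFractionRing O.toSubring K :=
  IsFractionRing.of_field O.toSubring K fun z => by
    obtain ⟨n, hn, h⟩ := O.exists_int_mul_mem z
    have hn' : (n : K) ≠ 0 := Int.cast_ne_zero.2 hn
    refine ⟨⟨n * z, h⟩, (n : O.toSubring), ?_⟩
    have h1 : algebraMap O.toSubring K (n : O.toSubring) = (n : K) := map_intCast _ n
    have h2 : algebraMap O.toSubring K ⟨n * z, h⟩ = n * z := rfl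
    rw [h1, h2]
    field_simp

/-- The Chow group of an order. -/
abbrev ChowGroup : Type _ := OneDim.ChowGroup O.toSubring K

end NumberFieldOrder

/-! ### The quadratic fields `ℚ(√p*)` -/

/-- `p* = (-1)^((p-1)/2) p`, for an odd prime `p`. -/
def primeStar (p : ℕ) : ℤ := (-1) ^ ((p - 1) / 2) * p

/-- The subfield `ℚ(√d)` of `ℂ`, generated by the two square roots of `d`. -/
noncomputable def sqrtField (d : ℤ) : IntermediateField ℚ ℂ :=
  IntermediateField.adjoin ℚ {α : ℂ | α ^ 2 = d}

/-! Put ω = (1 + √p*)/2 and take the order O = ℤ[nω], where n is a product of split primes. Counting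
O/aO through lengths shows that the orders of `a` at the places above a prime l, weighted by residue
degrees, sum to the l-adic valuation of the norm of `a` (`sum_residueVal_mul_ordNat`). If only one
place lies above l, the norm alone therefore determines the order there. This happens when l is
inert, when l = p, and when l divides n: making the order singular at a split prime glues its two
places together.

Every place q is then principal, by induction on the prime l below it. An inert l is a generator
itself, and √p* serves for l = p. For l > p split, some nω - nd in q has norm n²(d² - d + k) with
|d² - d + k| < l², so dividing by n leaves q plus places above primes smaller than l. There remain
the finitely many split l < p. All of them are put into n, so it suffices that l be the norm of a
fraction whose denominator has no split prime outside n in its norm; such primes are put into n as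
well (`exists_conductor`).

That l is a norm from ℚ(√p*) reflects that only one prime ramifies. Reciprocity makes l a square
modulo p, and a pigeonhole argument for x² - p*y² - lz² modulo pl then produces the element
(`exists_norm_eq_prime_mul_norm`). -/

namespace OneDim

/-! ### Local lengths and cardinalities of finite modules -/

section

universe u

variable {R : Type u} [CommRing R]

/-- The length of the localization of `M` at the prime `q`. -/
noncomputable def localLength (q : Ideal R) [q.IsPrime] (M : Type*) [AddCommGroup M] [Module R M] :
    ℕ∞ :=
  Module.length (Localization.AtPrime q) (LocalizedModule q.primeCompl M)

theorem localLength_add_of_exact (q : Ideal R) [q.IsPrime] {M N P : Type*} [AddCommGroup M]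
    [Module R M] [AddCommGroup N] [Module R N] [AddCommGroup P] [Module R P]
    (f : M →ₗ[R] N) (g : N →ₗ[R] P) (hf : Function.Injective f) (hg : Function.Surjective g)
    (h : Function.Exact f g) : localLength q N = localLength q M + localLength q P :=
  Module.length_eq_add_of_exact (LocalizedModule.map q.primeCompl f)
    (LocalizedModule.map q.primeCompl g) (LocalizedModule.map_injective _ _ hf)
    (LocalizedModule.map_surjective _ _ hg) (LocalizedModule.map_exact _ _ _ h)

theorem localLength_of_subsingleton (q : Ideal R) [q.IsPrime] {M : Type*} [AddCommGroup M]
    [Module R M] [Subsingleton M] : localLength q M = 0 := by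
  have : Subsingleton (LocalizedModule q.primeCompl M) := inferInstance
  exact Module.length_eq_zero

theorem localLength_congr (q : Ideal R) [q.IsPrime] {M N : Type*} [AddCommGroup M]
    [Module R M] [AddCommGroup N] [Module R N] (e : M ≃ₗ[R] N) :
    localLength q M = localLength q N := by
  have h := localLength_add_of_exact q e.toLinearMap (0 : N →ₗ[R] PUnit) e.injective
    (Function.surjective_to_subsingleton _) (by intro y; simp)
  rw [h, localLength_of_subsingleton q (M := PUnit), add_zero]

theorem localLength_quotient (q : Ideal R) [q.IsPrime] (I : Ideal R) :
    localLength q (R ⧸ I) = Module.length (Localization.AtPrime q)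
      (Localization.AtPrime q ⧸ I.map (algebraMap R (Localization.AtPrime q))) := by
  have h := Ideal.localized'_eq_map (Localization.AtPrime q) q.primeCompl I
  rw [← h]
  exact ((IsLocalizedModule.linearEquiv q.primeCompl (LocalizedModule.mkLinearMap _ _)
    (Submodule.toLocalizedQuotient' (Localization.AtPrime q) q.primeCompl
      (Algebra.linearMap R (Localization.AtPrime q)) I)).extendScalarsOfIsLocalization q.primeCompl
        (Localization.AtPrime q)).length_eq

theorem localLength_quotient_span_singleton (q : Ideal R) [q.IsPrime] (a : R) :
    localLength q (R ⧸ Ideal.span {a}) = Module.length (Localization.AtPrime q)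
      (Localization.AtPrime q ⧸ Ideal.span {algebraMap R (Localization.AtPrime q) a}) := by
  rw [localLength_quotient, Ideal.map_span, Set.image_singleton]

theorem localLength_quotient_self (q : Ideal R) [q.IsPrime] : localLength q (R ⧸ q) = 1 := by
  rw [localLength_quotient, Localization.AtPrime.map_eq_maximalIdeal, Module.length_eq_one_iff,
    isSimpleModule_iff_isCoatom]
  exact (IsLocalRing.maximalIdeal.isMaximal _).out

theorem localLength_quotient_of_not_le (q : Ideal R) [q.IsPrime] {I : Ideal R} (h : ¬ I ≤ q) :
    localLength q (R ⧸ I) = 0 := by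
  obtain ⟨s, hs, hsq⟩ := SetLike.not_le_iff_exists.1 h
  rw [localLength_quotient, Module.length_eq_zero_iff, Ideal.Quotient.subsingleton_iff]
  exact Ideal.eq_top_of_isUnit_mem _ (Ideal.mem_map_of_mem _ hs)
    (IsLocalization.map_units (Localization.AtPrime q) (⟨s, hsq⟩ : q.primeCompl))

/-- The `l`-adic valuation of the cardinality of the residue ring at `q`; this is the residue
degree when `q` lies over `l`. -/
noncomputable def residueVal (l : ℕ) (q : Ideal R) : ℕ := padicValNat l (Nat.card (R ⧸ q))

theorem natCast_mem_of_dvd_card {l : ℕ} (hl : l.Prime) (q : Ideal R) [q.IsPrime] [Finite (R ⧸ q)]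
    (h : l ∣ Nat.card (R ⧸ q)) : (l : R) ∈ q := by
  have := Fact.mk hl
  obtain ⟨x, hx⟩ := exists_prime_addOrderOf_dvd_card' l h
  have hx0 : x ≠ 0 := by
    rintro rfl
    simp at hx
    exact hl.one_lt.ne hx
  have h1 := addOrderOf_nsmul_eq_zero x
  rw [hx, nsmul_eq_mul] at h1
  rw [← Ideal.Quotient.eq_zero_iff_mem, map_natCast]
  exact (mul_eq_zero.1 h1).resolve_right hx0

/-- Both sides are additive in short exact sequences, so dévissage reduces to M = R/p with R/p
finite, hence a field. -/
theorem padicValNat_card_eq_sum_localLength [IsNoetherianRing R] {l : ℕ} (hl : l.Prime)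
    (S : Finset (MaximalSpectrum R)) (hS : ∀ q : MaximalSpectrum R, (l : R) ∈ q.asIdeal → q ∈ S)
    (M : Type u) [AddCommGroup M] [Module R M] [Module.Finite R M] [Finite M] :
    (padicValNat l (Nat.card M) : ℕ∞) =
      ∑ q ∈ S, (residueVal l q.asIdeal : ℕ∞) * localLength q.asIdeal M := by
  have := Fact.mk hl
  suffices H : Finite M → (padicValNat l (Nat.card M) : ℕ∞) =
      ∑ q ∈ S, (residueVal l q.asIdeal : ℕ∞) * localLength q.asIdeal M from H inferInstance
  refine IsNoetherianRing.induction_on_isQuotientEquivQuotientPrime R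
    (motive := fun N _ _ _ => Finite N → (padicValNat l (Nat.card N) : ℕ∞) =
      ∑ q ∈ S, (residueVal l q.asIdeal : ℕ∞) * localLength q.asIdeal N)
    (inferInstance : Module.Finite R M) ?_ ?_ ?_
  · intro N _ _ _ _ _
    simp [localLength_of_subsingleton]
  · intro N _ _ _ p e hN
    have hfin : Finite (R ⧸ p.1) := Finite.of_equiv N e.toEquiv
    have hmax : p.1.IsMaximal :=
      Ideal.Quotient.maximal_of_isField _ (Finite.isField_of_domain (R ⧸ p.1))
    rw [Nat.card_congr e.toEquiv]
    simp_rw [localLength_congr _ e]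
    have hne : ∀ q : MaximalSpectrum R, q ≠ ⟨p.1, hmax⟩ → localLength q.asIdeal (R ⧸ p.1) = 0 := by
      intro q hq
      refine localLength_quotient_of_not_le _ fun hle => hq ?_
      exact MaximalSpectrum.ext (hmax.eq_of_le q.isMaximal.ne_top hle).symm
    by_cases hp : (l : R) ∈ p.1
    · rw [Finset.sum_eq_single_of_mem ⟨p.1, hmax⟩ (hS _ hp)
        fun q _ hq => by rw [hne q hq, mul_zero]]
      rw [localLength_quotient_self, mul_one]
      rfl
    -- Here p does not lie above l: its weight is zero, so it may belong to `S` harmlessly.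
    · have hv : padicValNat l (Nat.card (R ⧸ p.1)) = 0 :=
        padicValNat.eq_zero_of_not_dvd fun h => hp (natCast_mem_of_dvd_card hl p.1 h)
      rw [hv, Finset.sum_eq_zero, Nat.cast_zero]
      intro q _
      by_cases hq : q = ⟨p.1, hmax⟩
      · subst hq
        simp [residueVal, hv]
      · rw [hne q hq, mul_zero]
  · intro N₁ _ _ _ N₂ _ _ _ N₃ _ _ _ f g hf hg hfg h₁ h₃ hN
    have hf1 : Finite N₁ := Finite.of_injective f hf
    have hf3 : Finite N₃ := Finite.of_surjective g hg
    have hc : Nat.card N₂ = Nat.card N₁ * Nat.card N₃ := by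
      rw [Submodule.card_eq_card_quotient_mul_card (LinearMap.range f)]
      congr 1
      · exact (Nat.card_congr (LinearEquiv.ofInjective f hf).toEquiv).symm
      · exact Nat.card_congr (hfg.linearEquivOfSurjective hg).toEquiv
    rw [hc, padicValNat.mul Nat.card_pos.ne' Nat.card_pos.ne', Nat.cast_add, h₁ hf1, h₃ hf3,
      ← Finset.sum_add_distrib]
    refine Finset.sum_congr rfl fun q _ => ?_
    rw [localLength_add_of_exact q.asIdeal f g hf hg hfg, mul_add]

end

/-! ### Orders of vanishing of ring elements -/

section

universe u

variable {R : Type u} [CommRing R] [IsDomain R] [IsNoetherianRing R] [Ring.DimensionLEOne R]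
variable {K : Type*} [Field K] [Algebra R K] [IsFractionRing R K]

theorem localLength_ne_top (q : Ideal R) [q.IsPrime] {a : R} (ha : a ≠ 0) :
    localLength q (R ⧸ Ideal.span {a}) ≠ ⊤ := by
  have := localization_dimensionLEOne R q
  rw [localLength_quotient_span_singleton]
  refine Ring.ord_ne_top (mem_nonZeroDivisors_of_ne_zero ?_)
  rwa [Ne, IsLocalization.to_map_eq_zero_iff _ q.primeCompl_le_nonZeroDivisors]

/-- The order of vanishing of an element of `R` at `q`. -/
noncomputable def ordNat (q : Ideal R) [q.IsPrime] (a : R) : ℕ :=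
  (localLength q (R ⧸ Ideal.span {a})).toNat

theorem ord_div_eq (q : Ideal R) [q.IsPrime] (x : Kˣ) {a b : R} (ha : a ≠ 0) (hb : b ≠ 0)
    (hx : (x : K) = algebraMap R K a / algebraMap R K b) :
    ord R K q (Additive.ofMul x) = (ordNat q a : ℤ) - ordNat q b := by
  rw [ord_div q x ha hb hx, ordNat, ordNat, localLength_quotient_span_singleton,
    localLength_quotient_span_singleton]

theorem ordNat_eq_zero_of_notMem {q : Ideal R} [q.IsPrime] {a : R} (h : a ∉ q) :
    ordNat q a = 0 := by
  rw [ordNat, localLength_quotient_span_singleton, length_eq_zero_of_notMem q h]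
  rfl

theorem ordNat_pos_of_mem {q : Ideal R} [q.IsPrime] {a : R} (ha : a ≠ 0) (h : a ∈ q) :
    0 < ordNat q a := by
  have h1 : localLength q (R ⧸ Ideal.span {a}) ≠ 0 := by
    rw [localLength_quotient_span_singleton, Ne, Module.length_eq_zero_iff,
      Ideal.Quotient.subsingleton_iff, Ideal.span_singleton_eq_top]
    exact fun hu => (IsLocalization.AtPrime.isUnit_to_map_iff (Localization.AtPrime q) q a).1 hu h
  have h2 := localLength_ne_top q ha
  rw [ordNat, Nat.pos_iff_ne_zero, Ne, ENat.toNat_eq_zero]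
  tauto

theorem padicValNat_card_quotient_span_singleton {l : ℕ} (hl : l.Prime)
    (S : Finset (MaximalSpectrum R)) (hS : ∀ q : MaximalSpectrum R, (l : R) ∈ q.asIdeal → q ∈ S)
    {a : R} (ha : a ≠ 0) [Finite (R ⧸ Ideal.span {a})] :
    padicValNat l (Nat.card (R ⧸ Ideal.span {a})) =
      ∑ q ∈ S, residueVal l q.asIdeal * ordNat q.asIdeal a := by
  have h := padicValNat_card_eq_sum_localLength hl S hS (R ⧸ Ideal.span {a})
  have h2 : ∀ q : MaximalSpectrum R, localLength q.asIdeal (R ⧸ Ideal.span {a}) =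
      (ordNat q.asIdeal a : ℕ∞) := fun q =>
    (ENat.natCast_toNat (localLength_ne_top q.asIdeal ha)).symm
  simp_rw [h2] at h
  exact_mod_cast h

end

end OneDim

/-! ### Arithmetic of p*: reciprocity and norms from ℚ(√p*) -/

theorem primeStar_of_mod_four_eq_one {p : ℕ} (h : p % 4 = 1) : primeStar p = p := by
  have : Even ((p - 1) / 2) := Nat.even_iff.2 (by omega)
  rw [primeStar, this.neg_one_pow, one_mul]

theorem primeStar_of_mod_four_eq_three {p : ℕ} (h : p % 4 = 3) : primeStar p = -p := by
  have : Odd ((p - 1) / 2) := Nat.odd_iff.2 (by omega)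
  rw [primeStar, this.neg_one_pow, neg_one_mul]

theorem Nat.Prime.mod_four_eq_one_or_three {p : ℕ} (hp : p.Prime) (hp2 : p ≠ 2) :
    p % 4 = 1 ∨ p % 4 = 3 := by
  have := hp.eq_two_or_odd
  omega

theorem primeStar_eq_or_eq_neg {p : ℕ} (hp : p.Prime) (hp2 : p ≠ 2) :
    primeStar p = p ∨ primeStar p = -p :=
  (hp.mod_four_eq_one_or_three hp2).imp primeStar_of_mod_four_eq_one primeStar_of_mod_four_eq_three

theorem exists_one_sub_primeStar {p : ℕ} (hp : p.Prime) (hp2 : p ≠ 2) :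
    ∃ k : ℤ, primeStar p = 1 - 4 * k := by
  rcases hp.mod_four_eq_one_or_three hp2 with h | h
  · rw [primeStar_of_mod_four_eq_one h]
    exact ⟨-(p / 4 : ℕ), by omega⟩
  · rw [primeStar_of_mod_four_eq_three h]
    exact ⟨(p / 4 : ℕ) + 1, by omega⟩

theorem sq_ne_primeStar {p : ℕ} (hp : p.Prime) (hp2 : p ≠ 2) (x : ℤ) : x ^ 2 ≠ primeStar p := by
  intro h
  have h1 : (x ^ 2).natAbs = p := by
    rcases primeStar_eq_or_eq_neg hp hp2 with h' | h' <;> rw [h, h'] <;> simp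
  rw [Int.natAbs_pow] at h1
  exact hp.prime.not_isSquare ⟨x.natAbs, by rw [← h1, sq]⟩

/-- A zero with y ≠ 0 would make p* the square of x/y, which is an integer because y² divides x². -/
theorem sq_sub_primeStar_mul_sq_ne_zero {p : ℕ} (hp : p.Prime) (hp2 : p ≠ 2) {x y : ℤ}
    (h : x ≠ 0 ∨ y ≠ 0) : x ^ 2 - primeStar p * y ^ 2 ≠ 0 := by
  intro h0
  have hy : y ≠ 0 := by
    rintro rfl
    simp at h0
    tauto
  have hdvd : y ∣ x := (Int.pow_dvd_pow_iff two_ne_zero).1 ⟨primeStar p, by linarith⟩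
  obtain ⟨z, rfl⟩ := hdvd
  refine sq_ne_primeStar hp hp2 z ?_
  have : y ^ 2 * (z ^ 2 - primeStar p) = 0 := by linear_combination h0
  have := (mul_eq_zero.1 this).resolve_left (pow_ne_zero 2 hy)
  linarith

/-- Quadratic reciprocity for `p*`: if `X ^ 2 - X + (1 - p*) / 4` has a root modulo `l` then `l` is
a square modulo `p`. -/
theorem isSquare_of_dvd_sq_sub {p l : ℕ} (hp : p.Prime) (hp2 : p ≠ 2) (hl : l.Prime)
    (hlp : l ≠ p) {k b : ℤ} (hk : primeStar p = 1 - 4 * k) (hb : (l : ℤ) ∣ b ^ 2 - b + k) :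
    IsSquare (l : ZMod p) := by
  have := Fact.mk hp
  have := Fact.mk hl
  by_cases hl2 : l = 2
  · subst hl2
    rw [Nat.cast_ofNat, ZMod.exists_sq_eq_two_iff hp2]
    -- Since b² - b is even, k is even, so p* ≡ 1 and p ≡ ±1 modulo 8.
    have h2 : (2 : ℤ) ∣ b ^ 2 - b := by
      have := Int.even_mul_succ_self (b - 1)
      rw [sub_add_cancel, sub_mul, one_mul, ← sq] at this
      exact this.two_dvd
    have h3 : (2 : ℤ) ∣ k := (Int.dvd_add_right h2).1 (by exact_mod_cast hb)
    rcases hp.mod_four_eq_one_or_three hp2 with h | h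
    · rw [primeStar_of_mod_four_eq_one h] at hk
      omega
    · rw [primeStar_of_mod_four_eq_three h] at hk
      omega
  -- Completing the square: (2b - 1)² - p* = 4(b² - b + k).
  have hd : IsSquare ((primeStar p : ℤ) : ZMod l) := by
    refine ⟨((2 * b - 1 : ℤ) : ZMod l), ?_⟩
    rw [← Int.cast_mul, ← sub_eq_zero, ← Int.cast_sub, ZMod.intCast_zmod_eq_zero_iff_dvd]
    rw [show primeStar p - (2 * b - 1) * (2 * b - 1) = (b ^ 2 - b + k) * (-4) by rw [hk]; ring]
    exact hb.mul_right _
  rcases hp.mod_four_eq_one_or_three hp2 with h | h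
  · rw [primeStar_of_mod_four_eq_one h, Int.cast_natCast] at hd
    exact (ZMod.exists_sq_eq_prime_iff_of_mod_four_eq_one h hl2).2 hd
  · rw [primeStar_of_mod_four_eq_three h, Int.cast_neg, Int.cast_natCast] at hd
    rcases hl.mod_four_eq_one_or_three hl2 with h' | h'
    · refine (ZMod.exists_sq_eq_prime_iff_of_mod_four_eq_one h' hp2).1 ?_
      have h1 : IsSquare (-1 : ZMod l) := ZMod.exists_sq_eq_neg_one_iff.2 (by omega)
      simpa using h1.mul hd
    · refine (ZMod.exists_sq_eq_prime_iff_of_mod_four_eq_three h h' hlp.symm).2 fun hsq => ?_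
      have hp0 : (p : ZMod l) ≠ 0 := by
        rw [Ne, ZMod.natCast_eq_zero_iff]
        exact fun hdvd => hlp ((Nat.prime_dvd_prime_iff_eq hl hp).1 hdvd)
      have h1 : IsSquare (-1 : ZMod l) := by
        have := hd.div hsq
        rwa [neg_div, div_self hp0] at this
      exact ZMod.exists_sq_eq_neg_one_iff.1 h1 h'

/-- A small nontrivial solution of two linear congruences in three unknowns. -/
theorem exists_small_of_linear_congruences {p l : ℕ} (hp : p.Prime) (hl : l.Prime) (w u : ℤ) :
    ∃ x y z : ℤ, (x ≠ 0 ∨ y ≠ 0 ∨ z ≠ 0) ∧ x ^ 2 ≤ p * l ∧ y ^ 2 < l ∧ z ^ 2 < p ∧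
      (l : ℤ) ∣ x - w * y ∧ (p : ℤ) ∣ x - u * z := by
  have := Fact.mk hp
  have := Fact.mk hl
  let F : Fin (Nat.sqrt (p * l) + 1) × Fin (Nat.sqrt l + 1) × Fin (Nat.sqrt p + 1) →
      ZMod l × ZMod p := fun t =>
    ((((t.1 : ℕ) : ℤ) - w * ((t.2.1 : ℕ) : ℤ) : ℤ), (((t.1 : ℕ) : ℤ) - u * ((t.2.2 : ℕ) : ℤ) : ℤ))
  -- The box sides exceed √(pl), √l and √p, so the box has more than pl points; the squares are
  -- compared to stay in ℕ.
  have hcard : Fintype.card (ZMod l × ZMod p) <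
      Fintype.card (Fin (Nat.sqrt (p * l) + 1) × Fin (Nat.sqrt l + 1) × Fin (Nat.sqrt p + 1)) := by
    simp only [Fintype.card_prod, ZMod.card, Fintype.card_fin]
    have h1 := Nat.lt_succ_sqrt (p * l)
    have h2 := Nat.lt_succ_sqrt l
    have h3 := Nat.lt_succ_sqrt p
    simp only [Nat.succ_eq_add_one] at h1 h2 h3
    generalize Nat.sqrt (p * l) + 1 = A at *
    generalize Nat.sqrt l + 1 = B at *
    generalize Nat.sqrt p + 1 = C at *
    have h4 : (p * l) * (l * p) < (A * A) * ((B * B) * (C * C)) :=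
      Nat.mul_lt_mul'' h1 (Nat.mul_lt_mul'' h2 h3)
    by_contra! h5
    have := Nat.mul_le_mul h5 h5
    nlinarith
  obtain ⟨s, t, hst, hF⟩ := Fintype.exists_ne_map_eq_of_card_lt F hcard
  have hsq : ∀ {n : ℕ} (a b : Fin (Nat.sqrt n + 1)),
      ((((a : ℕ) : ℤ) - ((b : ℕ) : ℤ)) ^ 2 ≤ n) := by
    intro n a b
    have ha := Nat.lt_succ_iff.1 a.2
    have hb := Nat.lt_succ_iff.1 b.2
    have hn : (Nat.sqrt n : ℤ) * Nat.sqrt n ≤ n := by exact_mod_cast Nat.sqrt_le n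
    have : |((a : ℕ) : ℤ) - ((b : ℕ) : ℤ)| ≤ Nat.sqrt n := by
      rw [abs_le]
      constructor <;> omega
    calc _ = |((a : ℕ) : ℤ) - ((b : ℕ) : ℤ)| * |((a : ℕ) : ℤ) - ((b : ℕ) : ℤ)| := by
          rw [abs_mul_abs_self, sq]
      _ ≤ Nat.sqrt n * Nat.sqrt n := mul_le_mul this this (abs_nonneg _) (by positivity)
      _ ≤ n := hn
  -- The bounds by l and p are strict because a prime is not a square.
  have hlt : ∀ {n : ℕ} (_ : n.Prime) (x : ℤ), x ^ 2 ≤ n → x ^ 2 < n := by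
    intro n hn x hx
    refine lt_of_le_of_ne hx fun h => hn.prime.not_isSquare ⟨x.natAbs, ?_⟩
    zify
    rw [abs_mul_abs_self, ← h, sq]
  have hF1 : ((F s).1 - (F t).1) = 0 := by rw [hF, sub_self]
  have hF2 : ((F s).2 - (F t).2) = 0 := by rw [hF, sub_self]
  refine ⟨((s.1 : ℕ) : ℤ) - ((t.1 : ℕ) : ℤ), ((s.2.1 : ℕ) : ℤ) - ((t.2.1 : ℕ) : ℤ),
    ((s.2.2 : ℕ) : ℤ) - ((t.2.2 : ℕ) : ℤ), ?_, ?_, hlt hl _ (hsq _ _), hlt hp _ (hsq _ _), ?_, ?_⟩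
  · by_contra! h
    apply hst
    ext <;> omega
  · exact_mod_cast hsq s.1 t.1
  · simp only [F] at hF1
    rw [← Int.cast_sub, ZMod.intCast_zmod_eq_zero_iff_dvd] at hF1
    convert hF1 using 1
    ring
  · simp only [F] at hF2
    rw [← Int.cast_sub, ZMod.intCast_zmod_eq_zero_iff_dvd] at hF2
    convert hF2 using 1
    ring

/-- A prime `l ≠ p` that splits in `ℚ(√p*)` is the norm of an element of this field. -/
theorem exists_norm_eq_prime_mul_norm {p l : ℕ} (hp : p.Prime) (hp2 : p ≠ 2) (hl : l.Prime)
    (hlp : l ≠ p) {k b : ℤ} (hk : primeStar p = 1 - 4 * k) (hb : (l : ℤ) ∣ b ^ 2 - b + k) :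
    ∃ x y z t : ℤ, (z ≠ 0 ∨ t ≠ 0) ∧
      x ^ 2 - primeStar p * y ^ 2 = l * (z ^ 2 - primeStar p * t ^ 2) := by
  have := Fact.mk hp
  obtain ⟨u, hu⟩ := isSquare_of_dvd_sq_sub hp hp2 hl hlp hk hb
  -- Modulo l, 2b - 1 is a root of p*; modulo p, u is a root of l. Hence both primes divide x² -
  -- p*y² - lz².
  obtain ⟨x, y, z, h0, hx, hy, hz, hxy, hxz⟩ :=
    exists_small_of_linear_congruences hp hl (2 * b - 1) (ZMod.cast u : ℤ)
  have hpos : (0 : ℤ) < p := by exact_mod_cast hp.pos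
  have hlpos : (0 : ℤ) < l := by exact_mod_cast hl.pos
  have hpd : (p : ℤ) ∣ primeStar p := by
    rcases primeStar_eq_or_eq_neg hp hp2 with h | h
    · rw [h]
    · simp [h]
  have hl1 : (l : ℤ) ∣ x ^ 2 - primeStar p * y ^ 2 - l * z ^ 2 := by
    have h1 : (l : ℤ) ∣ (x - (2 * b - 1) * y) * (x + (2 * b - 1) * y) := hxy.mul_right _
    have h2 : (l : ℤ) ∣ (b ^ 2 - b + k) * (4 * y ^ 2) := hb.mul_right _
    have h3 : (l : ℤ) ∣ l * z ^ 2 := dvd_mul_right _ _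
    have h4 := dvd_sub (dvd_add h1 h2) h3
    rw [hk]
    ring_nf at h4 ⊢
    exact h4
  have hp1 : (p : ℤ) ∣ x ^ 2 - primeStar p * y ^ 2 - l * z ^ 2 := by
    have hu' : (p : ℤ) ∣ (ZMod.cast u : ℤ) ^ 2 - l := by
      rw [← ZMod.intCast_zmod_eq_zero_iff_dvd]
      push_cast
      simp [hu, sq]
    have h1 : (p : ℤ) ∣ (x - ZMod.cast u * z) * (x + ZMod.cast u * z) := hxz.mul_right _
    have h2 : (p : ℤ) ∣ ((ZMod.cast u : ℤ) ^ 2 - l) * z ^ 2 := hu'.mul_right _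
    have h3 : (p : ℤ) ∣ primeStar p * y ^ 2 := hpd.mul_right _
    have h4 := dvd_sub (dvd_add h1 h2) h3
    ring_nf at h4 ⊢
    exact h4
  have hcop : IsCoprime (p : ℤ) (l : ℤ) :=
    Nat.isCoprime_iff_coprime.2 ((Nat.coprime_primes hp hl).2 hlp.symm)
  obtain ⟨c, hc⟩ := hcop.mul_dvd hp1 hl1
  have hpl : (0 : ℤ) < p * l := mul_pos hpos hlpos
  have hpy : (p : ℤ) * y ^ 2 < p * l := mul_lt_mul_of_pos_left hy hpos
  have hlz : (l : ℤ) * z ^ 2 < p * l := by nlinarith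
  have hpy0 : 0 ≤ (p : ℤ) * y ^ 2 := by positivity
  have hlz0 : 0 ≤ (l : ℤ) * z ^ 2 := by positivity
  have hx0 : 0 ≤ x ^ 2 := by positivity
  -- By size, the multiple cpl of pl is 0 or -p*l. The second value, absorbed into the right-hand
  -- side, gives t = 1.
  have hcases : c = 0 ∨ p * c = - primeStar p := by
    rcases primeStar_eq_or_eq_neg hp hp2 with h | h
    · rw [h] at hc ⊢
      -- Equality would leave c = 1 possible; it is excluded because pl is not a square.
      have hx' : x ^ 2 ≠ p * l := by
        intro he
        have hsq : IsSquare (p * l) := ⟨x.natAbs, by zify; rw [abs_mul_abs_self, ← he, sq]⟩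
        exact hlp.symm ((Nat.prime_dvd_prime_iff_eq hp hl).1 (by
          obtain ⟨r, hr⟩ := hsq
          have hpr : p ∣ r := by
            have : p ∣ r * r := ⟨l, hr.symm⟩
            exact or_self_iff.1 (hp.dvd_mul.1 this)
          obtain ⟨s, rfl⟩ := hpr
          refine ⟨s * s, Nat.eq_of_mul_eq_mul_left hp.pos ?_⟩
          rw [hr]
          ring))
      have h1 : c < 1 := by
        have := lt_of_le_of_ne hx hx'
        by_contra! h1
        nlinarith
      have h2 : -2 < c := by
        by_contra! h1
        nlinarith
      have h3 : c = 0 ∨ c = -1 := by omega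
      refine h3.imp id ?_
      rintro rfl
      ring
    · rw [h] at hc ⊢
      have h1 : c < 2 := by
        by_contra! h1
        nlinarith
      have h2 : -1 < c := by
        by_contra! h1
        nlinarith
      have h3 : c = 0 ∨ c = 1 := by omega
      refine h3.imp id ?_
      rintro rfl
      ring
  rcases hcases with rfl | hc'
  · refine ⟨x, y, z, 0, Or.inl ?_, by linear_combination hc⟩
    rintro rfl
    refine sq_sub_primeStar_mul_sq_ne_zero hp hp2 (x := x) (y := y) ?_ (by linear_combination hc)
    simpa using h0
  · exact ⟨x, y, z, 1, Or.inr one_ne_zero, by linear_combination hc + l * hc'⟩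

/-! ### The orders ℤ[nω] and their norm form -/

namespace OneDim

/-- `R` is the free `ℤ`-module with basis `1, θ`, where `θ = n * ω` and `ω ^ 2 = ω - k`. -/
structure IsQuadraticGenerator {R : Type*} [CommRing R] (θ : R) (n k : ℤ) : Prop where
  sq_eq : θ ^ 2 = n * θ - n ^ 2 * k
  exists_eq (r : R) : ∃ u v : ℤ, r = u + v * θ
  eq_zero (u v : ℤ) : (u + v * θ : R) = 0 → u = 0 ∧ v = 0

namespace IsQuadraticGenerator

section

universe u

variable {R : Type u} [CommRing R] {θ : R} {n k : ℤ} (h : IsQuadraticGenerator θ n k)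

include h

theorem exists_basis : ∃ b : Module.Basis (Fin 2) ℤ R, b 0 = 1 ∧ b 1 = θ := by
  have hli : LinearIndependent ℤ ![(1 : R), θ] := by
    rw [LinearIndependent.pair_iff]
    intro s t hst
    exact h.eq_zero s t (by simpa using hst)
  refine ⟨Module.Basis.mk hli ?_, by rw [Module.Basis.mk_apply]; rfl,
    by rw [Module.Basis.mk_apply]; rfl⟩
  intro r _
  obtain ⟨u, v, rfl⟩ := h.exists_eq r
  have h1 : (1 : R) ∈ Submodule.span ℤ (Set.range ![(1 : R), θ]) :=
    Submodule.subset_span ⟨0, rfl⟩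
  have h2 : θ ∈ Submodule.span ℤ (Set.range ![(1 : R), θ]) := Submodule.subset_span ⟨1, rfl⟩
  simpa using add_mem (Submodule.smul_mem _ u h1) (Submodule.smul_mem _ v h2)

theorem charZero : CharZero R := by
  refine charZero_of_inj_zero fun m hm => ?_
  have := h.eq_zero m 0 (by simpa using hm)
  exact_mod_cast this.1

/-- The index of a principal ideal is the absolute value of the determinant of multiplication by its
generator, computed in the basis 1, θ. -/
theorem card_quotient_span_singleton [IsDomain R] {u v : ℤ} (ha : (u + v * θ : R) ≠ 0) :
    Nat.card (R ⧸ Ideal.span {(u + v * θ : R)}) =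
      (u ^ 2 + n * u * v + n ^ 2 * k * v ^ 2).natAbs := by
  obtain ⟨b, hb0, hb1⟩ := h.exists_basis
  have : Module.Free ℤ R := Module.Free.of_basis b
  have : Module.Finite ℤ R := Module.Finite.of_basis b
  have key := Submodule.natAbs_det_basis_change b
    ((Ideal.span {(u + v * θ : R)}).restrictScalars ℤ) (Ideal.basisSpanSingleton b ha)
  refine Eq.trans key.symm ?_
  congr 1
  have hr : ∀ s t : ℤ, b.repr (s + t * θ) 0 = s ∧ b.repr (s + t * θ) 1 = t := by
    intro s t
    have : (s + t * θ : R) = s • b 0 + t • b 1 := by simp [hb0, hb1]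
    rw [this, map_add, map_smul, map_smul, b.repr_self, b.repr_self]
    simp
  have e0 : (u + v * θ) * b 0 = (u : R) + v * θ := by rw [hb0, mul_one]
  have e1 : (u + v * θ) * b 1 = ((-n ^ 2 * k * v : ℤ) : R) + ((u + n * v : ℤ) : R) * θ := by
    rw [hb1]
    push_cast
    linear_combination (v : R) * h.sq_eq
  rw [Module.Basis.det_apply, Matrix.det_fin_two]
  simp only [Module.Basis.toMatrix_apply, Function.comp_apply]
  have c0 : (((Ideal.basisSpanSingleton b ha) 0 : Ideal.span {(u + v * θ : R)}) : R) =
      (u : R) + v * θ := by rw [Ideal.basisSpanSingleton_apply, e0]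
  have c1 : (((Ideal.basisSpanSingleton b ha) 1 : Ideal.span {(u + v * θ : R)}) : R) =
      ((-n ^ 2 * k * v : ℤ) : R) + ((u + n * v : ℤ) : R) * θ := by
    rw [Ideal.basisSpanSingleton_apply, e1]
  erw [c0, c1]
  rw [(hr _ _).1, (hr _ _).2, (hr _ _).1, (hr _ _).2]
  ring

theorem add_mul_ne_zero {u v : ℤ} (huv : u ≠ 0 ∨ v ≠ 0) : (u + v * θ : R) ≠ 0 := by
  intro h0
  have := h.eq_zero u v h0
  tauto

end

end IsQuadraticGenerator

end OneDim

/-! ### Residue fields and places above a rational prime -/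

namespace OneDim

section

variable {R : Type*} [CommRing R]

theorem isCoprime_of_prime_of_not_dvd {l : ℕ} (hl : l.Prime) {m : ℤ} (h : ¬ (l : ℤ) ∣ m) :
    IsCoprime (l : ℤ) m :=
  (Nat.prime_iff_prime_int.1 hl).coprime_iff_not_dvd.2 h

theorem dvd_of_intCast_mem {q : Ideal R} (hq : q ≠ ⊤) {l : ℕ} (hl : l.Prime) (hlq : (l : R) ∈ q)
    {m : ℤ} (hm : (m : R) ∈ q) : (l : ℤ) ∣ m := by
  by_contra h
  obtain ⟨a, b, hab⟩ := isCoprime_of_prime_of_not_dvd hl h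
  refine hq ((Ideal.eq_top_iff_one q).2 ?_)
  have : (1 : R) = a * l + b * m := by
    rw [← Int.cast_one, ← hab]
    push_cast
    ring
  rw [this]
  exact add_mem (q.mul_mem_left _ hlq) (q.mul_mem_left _ hm)

theorem intCast_mem_of_dvd {q : Ideal R} {l : ℕ} (hlq : (l : R) ∈ q) {m : ℤ} (h : (l : ℤ) ∣ m) :
    (m : R) ∈ q := by
  obtain ⟨c, rfl⟩ := h
  push_cast
  exact q.mul_mem_right _ hlq

theorem eq_of_natCast_mem {q : Ideal R} (hq : q ≠ ⊤) {l l' : ℕ} (hl : l.Prime) (hl' : l'.Prime)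
    (h : (l : R) ∈ q) (h' : (l' : R) ∈ q) : l = l' :=
  (Nat.prime_dvd_prime_iff_eq hl hl').1
    (Int.natCast_dvd_natCast.1 (dvd_of_intCast_mem hq hl h (m := l') (by exact_mod_cast h')))

theorem exists_prime_natCast_mem (q : Ideal R) [q.IsPrime] [Finite (R ⧸ q)] :
    ∃ l : ℕ, l.Prime ∧ (l : R) ∈ q := by
  obtain ⟨c, hc⟩ := CharP.exists (R ⧸ q)
  refine ⟨c, CharP.char_is_prime (R ⧸ q) c, ?_⟩
  rw [← Ideal.Quotient.eq_zero_iff_mem, map_natCast, CharP.cast_eq_zero]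

theorem card_quotient_eq_pow (q : Ideal R) [q.IsMaximal] [Finite (R ⧸ q)] {l : ℕ} (hl : l.Prime)
    (h : (l : R) ∈ q) : ∃ m : ℕ, 0 < m ∧ Nat.card (R ⧸ q) = l ^ m := by
  let := Ideal.Quotient.field q
  have := Fintype.ofFinite (R ⧸ q)
  obtain ⟨c, hc, m, hcp, hm⟩ := FiniteField.card' (R ⧸ q)
  have hcq : (c : R) ∈ q := by
    rw [← Ideal.Quotient.eq_zero_iff_mem, map_natCast, CharP.cast_eq_zero]
  obtain rfl := eq_of_natCast_mem Ideal.IsPrime.ne_top' hl hcp h hcq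
  exact ⟨m, m.pos, by rw [Nat.card_eq_fintype_card, hm]⟩

theorem residueVal_pos (q : Ideal R) [q.IsMaximal] [Finite (R ⧸ q)] {l : ℕ} (hl : l.Prime)
    (h : (l : R) ∈ q) : 0 < residueVal l q := by
  have := Fact.mk hl
  obtain ⟨m, hm, hc⟩ := card_quotient_eq_pow q hl h
  rwa [residueVal, hc, padicValNat.prime_pow]

/-- With residue degree one the residue field is the prime field, so integers represent all classes.
-/
theorem exists_sub_intCast_mem (q : Ideal R) [q.IsMaximal] [Finite (R ⧸ q)] {l : ℕ} (hl : l.Prime)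
    (h : (l : R) ∈ q) (h1 : residueVal l q = 1) (r : R) : ∃ c : ℤ, r - c ∈ q := by
  have := Fact.mk hl
  obtain ⟨m, hm, hc⟩ := card_quotient_eq_pow q hl h
  rw [residueVal, hc, padicValNat.prime_pow] at h1
  rw [h1, pow_one] at hc
  obtain ⟨c, hcp⟩ := CharP.exists (R ⧸ q)
  have hcq : (c : R) ∈ q := by
    rw [← Ideal.Quotient.eq_zero_iff_mem, map_natCast, CharP.cast_eq_zero]
  obtain rfl := eq_of_natCast_mem Ideal.IsPrime.ne_top' hl (CharP.char_is_prime (R ⧸ q) c) h hcq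
  have := Fintype.ofFinite (R ⧸ q)
  obtain ⟨y, hy⟩ := (ZMod.castHom_bijective (R ⧸ q)
    (by rw [← Nat.card_eq_fintype_card, hc])).surjective (Ideal.Quotient.mk q r)
  obtain ⟨t, rfl⟩ := ZMod.intCast_surjective y
  refine ⟨t, ?_⟩
  rw [← Ideal.Quotient.eq_zero_iff_mem, map_sub, ← hy]
  simp

end

section

variable {R : Type*} [CommRing R] [IsDomain R] [IsNoetherianRing R] [Ring.DimensionLEOne R]
variable {K : Type*} [Field K] [Algebra R K] [IsFractionRing R K]

/-- The divisor of a/b is q plus a combination of places already known to be principal. -/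
theorem single_mem_range_divHom {a b : R} (ha : a ≠ 0) (hb : b ≠ 0) (q : MaximalSpectrum R)
    (hq : ordNat q.asIdeal a = ordNat q.asIdeal b + 1)
    (h : ∀ q' : MaximalSpectrum R, q' ≠ q → ordNat q'.asIdeal a = ordNat q'.asIdeal b ∨
      Finsupp.single q' 1 ∈ (divHom R K).range) :
    Finsupp.single q 1 ∈ (divHom R K).range := by
  classical
  have hinj := IsFractionRing.injective R K
  have hx : algebraMap R K a / algebraMap R K b ≠ 0 :=
    div_ne_zero ((map_ne_zero_iff _ hinj).2 ha) ((map_ne_zero_iff _ hinj).2 hb)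
  have hD : ∀ q' : MaximalSpectrum R, divHom R K (Additive.ofMul (Units.mk0 _ hx)) q' =
      (ordNat q'.asIdeal a : ℤ) - ordNat q'.asIdeal b := fun q' => by
    rw [divHom_apply]
    exact ord_div_eq q'.asIdeal _ ha hb rfl
  have hDmem : divHom R K (Additive.ofMul (Units.mk0 _ hx)) ∈ (divHom R K).range := ⟨_, rfl⟩
  generalize divHom R K (Additive.ofMul (Units.mk0 _ hx)) = D at hD hDmem
  have hDq : D q = 1 := by
    rw [hD, hq]
    push_cast
    ring
  have hsum : Finsupp.single q 1 = D - ∑ q' ∈ D.support.erase q, D q' • Finsupp.single q' 1 := by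
    have hmem : q ∈ D.support := by simp [hDq]
    have h1 : D = ∑ q' ∈ D.support, D q' • Finsupp.single q' 1 := by
      conv_lhs => rw [← D.sum_single]
      simp [Finsupp.sum]
    rw [← Finset.add_sum_erase _ _ hmem, hDq, one_smul] at h1
    exact eq_sub_of_add_eq h1.symm
  rw [hsum]
  refine sub_mem hDmem (sum_mem fun q' hq' => AddSubgroup.zsmul_mem _ ?_ _)
  rw [Finset.mem_erase, Finsupp.mem_support_iff, hD] at hq'
  refine (h q' hq'.1).resolve_left fun he => hq'.2 ?_
  rw [he, sub_self]

end

/-- There is at most one maximal ideal above `l`. -/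
def UniqueAbove (R : Type*) [CommRing R] (l : ℕ) : Prop :=
  ∀ q q' : MaximalSpectrum R, (l : R) ∈ q.asIdeal → (l : R) ∈ q'.asIdeal → q = q'

namespace IsQuadraticGenerator

section

variable {R : Type*} [CommRing R] [IsDomain R] [IsNoetherianRing R] [Ring.DimensionLEOne R]
variable {θ : R} {n k : ℤ} (h : IsQuadraticGenerator θ n k)

include h

-- The norm is a multiple of the element; the cofactor is the conjugate u + nv - vθ.
omit [IsDomain R] [IsNoetherianRing R] [Ring.DimensionLEOne R] in
theorem norm_mem {q : Ideal R} {u v : ℤ} (hq : (u + v * θ : R) ∈ q) :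
    ((u ^ 2 + n * u * v + n ^ 2 * k * v ^ 2 : ℤ) : R) ∈ q := by
  have : ((u ^ 2 + n * u * v + n ^ 2 * k * v ^ 2 : ℤ) : R) =
      ((u + n * v : ℤ) - v * θ) * (u + v * θ) := by
    push_cast
    linear_combination (v : R) ^ 2 * h.sq_eq
  rw [this]
  exact q.mul_mem_left _ hq

omit [IsNoetherianRing R] [Ring.DimensionLEOne R] in
theorem finite_quotient_span_singleton {u v : ℤ} (ha : (u + v * θ : R) ≠ 0)
    (hQ : u ^ 2 + n * u * v + n ^ 2 * k * v ^ 2 ≠ 0) :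
    Finite (R ⧸ Ideal.span {(u + v * θ : R)}) := by
  apply Nat.finite_of_card_ne_zero
  rw [h.card_quotient_span_singleton ha]
  exact Int.natAbs_ne_zero.2 hQ

omit [IsNoetherianRing R] [Ring.DimensionLEOne R] in
theorem finite_quotient {q : Ideal R} {m : ℤ} (hm : m ≠ 0) (hmq : (m : R) ∈ q) :
    Finite (R ⧸ q) := by
  have hm' : ((m : R) + (0 : ℤ) * θ) ≠ 0 := h.add_mul_ne_zero (Or.inl hm)
  have := h.finite_quotient_span_singleton hm' (by simpa using hm)
  refine Finite.of_surjective (Ideal.Quotient.factor (S := Ideal.span {(m : R) + (0 : ℤ) * θ})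
    (T := q) ?_) (Ideal.Quotient.factor_surjective _)
  rw [Ideal.span_singleton_le_iff_mem]
  simpa using hmq

/-- Both sides are the l-adic valuation of the index of the principal ideal. This links orders of
vanishing with norms. -/
theorem sum_residueVal_mul_ordNat {l : ℕ} (hl : l.Prime) (S : Finset (MaximalSpectrum R))
    (hS : ∀ q : MaximalSpectrum R, (l : R) ∈ q.asIdeal → q ∈ S) {u v : ℤ}
    (ha : (u + v * θ : R) ≠ 0) (hQ : u ^ 2 + n * u * v + n ^ 2 * k * v ^ 2 ≠ 0) :
    ∑ q ∈ S, residueVal l q.asIdeal * ordNat q.asIdeal (u + v * θ) =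
      padicValInt l (u ^ 2 + n * u * v + n ^ 2 * k * v ^ 2) := by
  have := h.finite_quotient_span_singleton ha hQ
  rw [← padicValNat_card_quotient_span_singleton hl S hS ha, h.card_quotient_span_singleton ha]
  rfl

theorem exists_above {l : ℕ} (hl : l.Prime) : ∃ S : Finset (MaximalSpectrum R),
    ∀ q : MaximalSpectrum R, q ∈ S ↔ (l : R) ∈ q.asIdeal := by
  have := h.charZero
  have hl0 : (l : R) ≠ 0 := Nat.cast_ne_zero.2 hl.ne_zero
  exact ⟨(finite_maximal_mem hl0).toFinset, fun q => by simp⟩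

theorem residueVal_mul_ordNat_of_uniqueAbove {l : ℕ} (hl : l.Prime) (hu : UniqueAbove R l)
    {q : MaximalSpectrum R} (hq : (l : R) ∈ q.asIdeal) {u v : ℤ}
    (ha : (u + v * θ : R) ≠ 0) (hQ : u ^ 2 + n * u * v + n ^ 2 * k * v ^ 2 ≠ 0) :
    residueVal l q.asIdeal * ordNat q.asIdeal (u + v * θ) =
      padicValInt l (u ^ 2 + n * u * v + n ^ 2 * k * v ^ 2) := by
  rw [← h.sum_residueVal_mul_ordNat hl {q} (fun q' hq' => by simp [hu q' q hq' hq]) ha hQ,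
    Finset.sum_singleton]

omit [IsNoetherianRing R] [Ring.DimensionLEOne R] in
theorem residueVal_pos_of_mem {l : ℕ} (hl : l.Prime) {q : MaximalSpectrum R}
    (hq : (l : R) ∈ q.asIdeal) : 0 < residueVal l q.asIdeal := by
  have := q.isMaximal
  have := h.finite_quotient (q := q.asIdeal) (m := l) (by exact_mod_cast hl.ne_zero)
    (by exact_mod_cast hq)
  exact residueVal_pos q.asIdeal hl hq

/-- If the valuations of the norms agree above a prime with one place, or both norms are prime
to `l`, then the orders of vanishing agree. -/
theorem ordNat_eq_ordNat {l : ℕ} (hl : l.Prime) {q : MaximalSpectrum R}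
    (hq : (l : R) ∈ q.asIdeal) {u v s t : ℤ} (ha : (u + v * θ : R) ≠ 0) (hb : (s + t * θ : R) ≠ 0)
    (hQ : u ^ 2 + n * u * v + n ^ 2 * k * v ^ 2 ≠ 0)
    (hQ' : s ^ 2 + n * s * t + n ^ 2 * k * t ^ 2 ≠ 0)
    (hval : padicValInt l (u ^ 2 + n * u * v + n ^ 2 * k * v ^ 2) =
      padicValInt l (s ^ 2 + n * s * t + n ^ 2 * k * t ^ 2))
    (hu : UniqueAbove R l ∨ ¬ (l : ℤ) ∣ s ^ 2 + n * s * t + n ^ 2 * k * t ^ 2) :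
    ordNat q.asIdeal (u + v * θ) = ordNat q.asIdeal (s + t * θ) := by
  rcases hu with hu | hu
  · have h1 := h.residueVal_mul_ordNat_of_uniqueAbove hl hu hq ha hQ
    have h2 := h.residueVal_mul_ordNat_of_uniqueAbove hl hu hq hb hQ'
    rw [hval, ← h2] at h1
    exact Nat.eq_of_mul_eq_mul_left (h.residueVal_pos_of_mem hl hq) h1
  · have hqt := q.isMaximal.ne_top
    have hu' : ¬ (l : ℤ) ∣ u ^ 2 + n * u * v + n ^ 2 * k * v ^ 2 := by
      rw [padicValInt.eq_zero_of_not_dvd hu, padicValInt.eq_zero_iff] at hval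
      exact (hval.resolve_left hl.ne_one).resolve_left hQ
    rw [ordNat_eq_zero_of_notMem fun hm => hu (dvd_of_intCast_mem hqt hl hq (h.norm_mem hm)),
      ordNat_eq_zero_of_notMem fun hm => hu' (dvd_of_intCast_mem hqt hl hq (h.norm_mem hm))]

/-- If the order of vanishing has total weight `c` above `l` and each place contributes at
least `c`, then there is only one place. -/
theorem uniqueAbove_of_le {l : ℕ} (hl : l.Prime) {u v : ℤ}
    (ha : (u + v * θ : R) ≠ 0) (hQ : u ^ 2 + n * u * v + n ^ 2 * k * v ^ 2 ≠ 0)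
    (hpos : 0 < padicValInt l (u ^ 2 + n * u * v + n ^ 2 * k * v ^ 2))
    (hle : ∀ q : MaximalSpectrum R, (l : R) ∈ q.asIdeal →
      padicValInt l (u ^ 2 + n * u * v + n ^ 2 * k * v ^ 2) ≤
        residueVal l q.asIdeal * ordNat q.asIdeal (u + v * θ)) : UniqueAbove R l := by
  classical
  intro q q' hq hq'
  by_contra hne
  obtain ⟨S, hS⟩ := h.exists_above hl
  have h1 := h.sum_residueVal_mul_ordNat hl S (fun q hq => (hS q).2 hq) ha hQ
  have h2 : ∑ q ∈ ({q, q'} : Finset (MaximalSpectrum R)),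
      residueVal l q.asIdeal * ordNat q.asIdeal (u + v * θ) ≤
      ∑ q ∈ S, residueVal l q.asIdeal * ordNat q.asIdeal (u + v * θ) := by
    refine Finset.sum_le_sum_of_subset ?_
    intro r hr
    rw [Finset.mem_insert, Finset.mem_singleton] at hr
    rcases hr with rfl | rfl
    · exact (hS _).2 hq
    · exact (hS _).2 hq'
  rw [Finset.sum_pair hne, h1] at h2
  have := hle q hq
  have := hle q' hq'
  omega

-- As θ² = n(θ - nk), every maximal ideal above l contains θ, so an element u + vθ lies in it
-- exactly when l divides u.
omit [IsDomain R] [IsNoetherianRing R] [Ring.DimensionLEOne R] in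
theorem uniqueAbove_of_dvd {l : ℕ} (hl : l.Prime) (hln : (l : ℤ) ∣ n) : UniqueAbove R l := by
  have key : ∀ q q' : MaximalSpectrum R, (l : R) ∈ q.asIdeal → (l : R) ∈ q'.asIdeal →
      q.asIdeal ≤ q'.asIdeal := by
    have hθ : ∀ q : MaximalSpectrum R, (l : R) ∈ q.asIdeal → θ ∈ q.asIdeal := by
      intro q hq
      have hn := intCast_mem_of_dvd hq hln
      refine q.isMaximal.isPrime.mem_of_pow_mem 2 ?_
      rw [h.sq_eq, sq, mul_assoc]
      exact sub_mem (q.asIdeal.mul_mem_right _ hn) (q.asIdeal.mul_mem_right _ hn)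
    intro q q' hq hq' r hr
    obtain ⟨u, v, rfl⟩ := h.exists_eq r
    rw [add_mem_cancel_right (q.asIdeal.mul_mem_left _ (hθ q hq))] at hr
    exact add_mem (intCast_mem_of_dvd hq' (dvd_of_intCast_mem q.isMaximal.ne_top hl hq hr))
      (q'.asIdeal.mul_mem_left _ (hθ q' hq'))
  intro q q' hq hq'
  exact MaximalSpectrum.ext (le_antisymm (key q q' hq hq') (key q' q hq' hq))

end

end IsQuadraticGenerator

end OneDim

/-! ### Inert and ramified primes away from the conductor -/

namespace OneDim

namespace IsQuadraticGenerator

section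

variable {R : Type*} [CommRing R] [IsDomain R] [IsNoetherianRing R] [Ring.DimensionLEOne R]
variable {θ : R} {n k : ℤ} (h : IsQuadraticGenerator θ n k)
variable {p : ℕ} (hp : p.Prime) (hp2 : p ≠ 2) (hk : primeStar p = 1 - 4 * k) (hn : n ≠ 0)

-- Four times the form is (2u + nv)² - p*(nv)².
omit [IsDomain R] [IsNoetherianRing R] [Ring.DimensionLEOne R] in
include hp hp2 hk hn in
theorem norm_ne_zero {u v : ℤ} (huv : u ≠ 0 ∨ v ≠ 0) :
    u ^ 2 + n * u * v + n ^ 2 * k * v ^ 2 ≠ 0 := by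
  intro h0
  refine sq_sub_primeStar_mul_sq_ne_zero hp hp2 (x := 2 * u + n * v) (y := n * v) ?_ ?_
  · by_contra! hc
    have hv : v = 0 := (mul_eq_zero.1 hc.2).resolve_left hn
    rw [hv] at hc huv
    have := hc.1
    omega
  · rw [hk]
    linear_combination 4 * h0

include h hp hp2 hk hn

/-- The primes that do not split have a single place above them, at which `l` has order `1`. -/
theorem uniqueAbove_of_not_split {l : ℕ} (hl : l.Prime)
    (hs : ¬ ∃ b : ℤ, (l : ℤ) ∣ b ^ 2 - b + k) (hln : ¬ (l : ℤ) ∣ n) :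
    UniqueAbove R l ∧ ∀ q : MaximalSpectrum R, (l : R) ∈ q.asIdeal → ordNat q.asIdeal l = 1 := by
  have := Fact.mk hl
  have hl0 : (l : ℤ) ≠ 0 := by exact_mod_cast hl.ne_zero
  have hel : ((l : ℤ) : R) + (0 : ℤ) * θ = l := by simp
  have ha : ((l : ℤ) : R) + (0 : ℤ) * θ ≠ 0 := h.add_mul_ne_zero (Or.inl hl0)
  have hQ := norm_ne_zero hp hp2 hk hn (Or.inl hl0 : (l : ℤ) ≠ 0 ∨ (0 : ℤ) ≠ 0)
  have hval : padicValInt l ((l : ℤ) ^ 2 + n * l * 0 + n ^ 2 * k * 0 ^ 2) = 2 := by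
    rw [show (l : ℤ) ^ 2 + n * l * 0 + n ^ 2 * k * 0 ^ 2 = l * l by ring,
      padicValInt.mul hl0 hl0, padicValInt_self]
  have hpos : ∀ q : MaximalSpectrum R, (l : R) ∈ q.asIdeal →
      0 < ordNat q.asIdeal (l : R) := fun q hq => ordNat_pos_of_mem (hel ▸ ha) hq
  -- With residue degree one, θ would be congruent to an integer c, and c/n would be a root of X² -
  -- X + k modulo l.
  have hres : ∀ q : MaximalSpectrum R, (l : R) ∈ q.asIdeal → 2 ≤ residueVal l q.asIdeal := by
    intro q hq
    by_contra hlt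
    have h1 : residueVal l q.asIdeal = 1 := by
      have := h.residueVal_pos_of_mem hl hq
      omega
    have := q.isMaximal
    have := h.finite_quotient (q := q.asIdeal) hl0 (by exact_mod_cast hq)
    obtain ⟨c, hc⟩ := exists_sub_intCast_mem q.asIdeal hl hq h1 θ
    have hN := h.norm_mem (q := q.asIdeal) (u := -c) (v := 1) (by
      convert hc using 1
      push_cast
      ring)
    have hdvd := dvd_of_intCast_mem q.isMaximal.ne_top hl hq hN
    obtain ⟨s, t, hst⟩ := isCoprime_of_prime_of_not_dvd hl hln
    -- Here t is an inverse of n modulo l.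
    refine hs ⟨t * c, ?_⟩
    have e : (t * c) ^ 2 - t * c + k =
        t ^ 2 * ((-c) ^ 2 + n * -c * 1 + n ^ 2 * k * 1 ^ 2) +
          l * (s * (k * (1 + t * n) - t * c)) := by
      linear_combination (-(k * (1 + t * n)) + t * c) * hst
    rw [e]
    exact dvd_add (hdvd.mul_left _) (dvd_mul_right _ _)
  -- The norm l² gives total weight 2, which a single place of degree at least 2 already uses up.
  have hu : UniqueAbove R l := by
    refine h.uniqueAbove_of_le hl ha hQ (by rw [hval]; exact two_pos) fun q hq => ?_
    rw [hval, hel]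
    nlinarith [hres q hq, hpos q hq]
  refine ⟨hu, fun q hq => ?_⟩
  have h1 := h.residueVal_mul_ordNat_of_uniqueAbove hl hu hq ha hQ
  rw [hval, hel] at h1
  nlinarith [hres q hq, hpos q hq]

/-- The element 2θ - n is n√p*. Its norm -n²p* has valuation one at p, and it lies in every maximal
ideal above p, so there is room for only one. -/
theorem uniqueAbove_of_ramified (hpn : ¬ (p : ℤ) ∣ n) :
    UniqueAbove R p ∧ ∀ q : MaximalSpectrum R, (p : R) ∈ q.asIdeal →
      ordNat q.asIdeal (((-n : ℤ) : R) + (2 : ℤ) * θ) = 1 := by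
  have := Fact.mk hp
  have hp0 : (p : ℤ) ≠ 0 := by exact_mod_cast hp.ne_zero
  have ha : ((-n : ℤ) : R) + (2 : ℤ) * θ ≠ 0 := h.add_mul_ne_zero (Or.inr two_ne_zero)
  have hQ := norm_ne_zero hp hp2 hk hn (Or.inr two_ne_zero : (-n : ℤ) ≠ 0 ∨ (2 : ℤ) ≠ 0)
  have hnorm : (-n) ^ 2 + n * (-n) * 2 + n ^ 2 * k * 2 ^ 2 = - (n ^ 2 * primeStar p) := by
    rw [hk]
    ring
  have hpd : (p : ℤ) ∣ primeStar p := by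
    rcases primeStar_eq_or_eq_neg hp hp2 with h | h
    · rw [h]
    · simp [h]
  have hval : padicValInt p ((-n) ^ 2 + n * (-n) * 2 + n ^ 2 * k * 2 ^ 2) = 1 := by
    have h1 : padicValInt p (primeStar p) = 1 := by
      rcases primeStar_eq_or_eq_neg hp hp2 with h | h
      · rw [h, padicValInt_self]
      · rw [h, padicValInt, Int.natAbs_neg]
        exact padicValInt_self
    have hd0 : primeStar p ≠ 0 := by
      intro h0
      rw [h0] at h1
      simp at h1
    rw [hnorm, padicValInt, Int.natAbs_neg, ← padicValInt, padicValInt.mul (pow_ne_zero 2 hn) hd0,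
      h1, padicValInt.eq_zero_of_not_dvd]
    exact fun hd => hpn ((Nat.prime_iff_prime_int.1 hp).dvd_of_dvd_pow hd)
  have hpos : ∀ q : MaximalSpectrum R, (p : R) ∈ q.asIdeal →
      1 ≤ residueVal p q.asIdeal * ordNat q.asIdeal (((-n : ℤ) : R) + (2 : ℤ) * θ) := by
    intro q hq
    refine Nat.mul_pos (h.residueVal_pos_of_mem hp hq) (ordNat_pos_of_mem ha ?_)
    refine q.isMaximal.isPrime.mem_of_pow_mem 2 ?_
    have e : (((-n : ℤ) : R) + (2 : ℤ) * θ) ^ 2 = ((n ^ 2 * primeStar p : ℤ) : R) := by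
      rw [hk]
      push_cast
      linear_combination 4 * h.sq_eq
    rw [e]
    exact intCast_mem_of_dvd hq (hpd.mul_left _)
  have hu : UniqueAbove R p := by
    refine h.uniqueAbove_of_le hp ha hQ (by rw [hval]; exact one_pos) fun q hq => ?_
    rw [hval]
    exact hpos q hq
  refine ⟨hu, fun q hq => ?_⟩
  have h1 := h.residueVal_mul_ordNat_of_uniqueAbove hp hu hq ha hQ
  rw [hval] at h1
  exact Nat.eq_one_of_mul_eq_one_left h1

theorem uniqueAbove_or_split {l : ℕ} (hl : l.Prime) :
    UniqueAbove R l ∨ (¬ (l : ℤ) ∣ n ∧ l ≠ p ∧ ∃ b : ℤ, (l : ℤ) ∣ b ^ 2 - b + k) := by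
  by_cases hln : (l : ℤ) ∣ n
  · exact Or.inl (h.uniqueAbove_of_dvd hl hln)
  by_cases hlp : l = p
  · subst hlp
    exact Or.inl (h.uniqueAbove_of_ramified hp hp2 hk hn hln).1
  by_cases hs : ∃ b : ℤ, (l : ℤ) ∣ b ^ 2 - b + k
  · exact Or.inr ⟨hln, hlp, hs⟩
  · exact Or.inl (h.uniqueAbove_of_not_split hp hp2 hk hn hl hs hln).1

omit [IsNoetherianRing R] [Ring.DimensionLEOne R] in
theorem exists_prime_mem (q : MaximalSpectrum R) : ∃ l : ℕ, l.Prime ∧ (l : R) ∈ q.asIdeal := by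
  have hq : q.asIdeal.IsPrime := q.isMaximal.isPrime
  have h2 : (((2 : ℤ) : R) + (0 : ℤ) * θ) ≠ 0 := h.add_mul_ne_zero (Or.inl two_ne_zero)
  -- The ring is not a field: the quotient by 2 has four elements.
  have hbot : q.asIdeal ≠ ⊥ := by
    intro hb
    have htop : Ideal.span {((2 : ℤ) : R) + (0 : ℤ) * θ} = ⊤ := by
      refine (Ideal.isMaximal_def.1 q.isMaximal).2 _ ?_
      rw [hb, bot_lt_iff_ne_bot, Ne, Ideal.span_singleton_eq_bot]
      exact h2
    have hc := h.card_quotient_span_singleton h2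
    have : Subsingleton (R ⧸ Ideal.span {((2 : ℤ) : R) + (0 : ℤ) * θ}) :=
      Ideal.Quotient.subsingleton_iff.2 htop
    rw [Nat.card_unique] at hc
    norm_num at hc
  obtain ⟨r, hr, hr0⟩ := Submodule.exists_mem_ne_zero_of_ne_bot hbot
  obtain ⟨u, v, rfl⟩ := h.exists_eq r
  have huv : u ≠ 0 ∨ v ≠ 0 := by
    by_contra! hc
    exact hr0 (by simp [hc.1, hc.2])
  have := h.finite_quotient (norm_ne_zero hp hp2 hk hn huv) (h.norm_mem hr)
  exact exists_prime_natCast_mem q.asIdeal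

end

end IsQuadraticGenerator

end OneDim

/-! ### Every place is principal -/

namespace OneDim

namespace IsQuadraticGenerator

section

variable {R : Type*} [CommRing R] [IsDomain R] [IsNoetherianRing R] [Ring.DimensionLEOne R]
variable (K : Type*) [Field K] [Algebra R K] [IsFractionRing R K]
variable {θ : R} {n k : ℤ} (h : IsQuadraticGenerator θ n k)
variable {p : ℕ} (hp : p.Prime) (hp2 : p ≠ 2) (hk : primeStar p = 1 - 4 * k) (hn : n ≠ 0)

include h hp hp2 hk hn

theorem single_mem_of_not_split {l : ℕ} (hl : l.Prime)
    (hs : ¬ ∃ b : ℤ, (l : ℤ) ∣ b ^ 2 - b + k) (hln : ¬ (l : ℤ) ∣ n) {q : MaximalSpectrum R}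
    (hq : (l : R) ∈ q.asIdeal) : Finsupp.single q 1 ∈ (divHom R K).range := by
  have := h.charZero
  obtain ⟨hu, hord⟩ := h.uniqueAbove_of_not_split hp hp2 hk hn hl hs hln
  have h1 : ∀ q : MaximalSpectrum R, ordNat q.asIdeal (1 : R) = 0 := fun q =>
    ordNat_eq_zero_of_notMem ((Ideal.ne_top_iff_one _).1 q.isMaximal.ne_top)
  refine single_mem_range_divHom (Nat.cast_ne_zero.2 hl.ne_zero : (l : R) ≠ 0) one_ne_zero q ?_ ?_
  · rw [hord q hq, h1]
  · intro q' hq'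
    left
    rw [h1, ordNat_eq_zero_of_notMem]
    exact fun hm => hq' (hu q' q hm hq)

/-- The quotient (2θ - n)/n is √p*. Numerator and denominator have norms of equal valuation away
from p, so its divisor is concentrated above p. -/
theorem single_mem_of_ramified (hpn : ¬ (p : ℤ) ∣ n) {q : MaximalSpectrum R}
    (hq : (p : R) ∈ q.asIdeal) : Finsupp.single q 1 ∈ (divHom R K).range := by
  obtain ⟨hu, hord⟩ := h.uniqueAbove_of_ramified hp hp2 hk hn hpn
  have ha : ((-n : ℤ) : R) + (2 : ℤ) * θ ≠ 0 := h.add_mul_ne_zero (Or.inr two_ne_zero)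
  have hb : (n : R) + (0 : ℤ) * θ ≠ 0 := h.add_mul_ne_zero (Or.inl hn)
  have hQ := norm_ne_zero hp hp2 hk hn (Or.inr two_ne_zero : (-n : ℤ) ≠ 0 ∨ (2 : ℤ) ≠ 0)
  have hQ' := norm_ne_zero hp hp2 hk hn (Or.inl hn : n ≠ 0 ∨ (0 : ℤ) ≠ 0)
  have hnorm : (-n) ^ 2 + n * (-n) * 2 + n ^ 2 * k * 2 ^ 2 = n ^ 2 * (- primeStar p) := by
    rw [hk]
    ring
  have hnorm' : n ^ 2 + n * n * 0 + n ^ 2 * k * 0 ^ 2 = n ^ 2 := by ring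
  refine single_mem_range_divHom ha hb q ?_ ?_
  · rw [hord q hq, ordNat_eq_zero_of_notMem]
    intro hm
    rw [Int.cast_zero, zero_mul, add_zero] at hm
    exact hpn (dvd_of_intCast_mem q.isMaximal.ne_top hp hq hm)
  · intro q' hq'
    left
    obtain ⟨l, hl, hlq⟩ := h.exists_prime_mem hp hp2 hk hn q'
    have := Fact.mk hl
    have hlp : l ≠ p := by
      rintro rfl
      exact hq' (hu q' q hlq hq)
    have hld : ¬ (l : ℤ) ∣ - primeStar p := by
      rw [dvd_neg]
      intro hd
      refine hlp ((Nat.prime_dvd_prime_iff_eq hl hp).1 (Int.natCast_dvd_natCast.1 ?_))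
      rcases primeStar_eq_or_eq_neg hp hp2 with h | h <;> rw [h] at hd
      · exact hd
      · exact (dvd_neg.1 hd)
    have hd0 : - primeStar p ≠ 0 := fun h0 => hld (by rw [h0]; exact dvd_zero _)
    refine h.ordNat_eq_ordNat hl hlq ha hb hQ hQ' ?_ ?_
    · rw [hnorm, hnorm', padicValInt.mul (pow_ne_zero 2 hn) hd0,
        padicValInt.eq_zero_of_not_dvd hld, add_zero]
    · refine (h.uniqueAbove_or_split hp hp2 hk hn hl).imp id fun hs => ?_
      rw [hnorm']
      exact fun hd => hs.1 ((Nat.prime_iff_prime_int.1 hl).dvd_of_dvd_pow hd)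

/-- Above a split prime `l > p`, each place is linearly equivalent to a combination of places above
smaller primes. -/
theorem single_mem_of_split_of_lt {l : ℕ} (hl : l.Prime) (hpl : p < l) {b : ℤ}
    (hb : (l : ℤ) ∣ b ^ 2 - b + k) {q : MaximalSpectrum R} (hq : (l : R) ∈ q.asIdeal)
    (ih : ∀ l' : ℕ, l' < l → l'.Prime → ∀ q' : MaximalSpectrum R, (l' : R) ∈ q'.asIdeal →
      Finsupp.single q' 1 ∈ (divHom R K).range) :
    Finsupp.single q 1 ∈ (divHom R K).range := by
  have := Fact.mk hl
  have hlpos : (0 : ℤ) < l := by exact_mod_cast hl.pos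
  -- The roots modulo l are b and 1 - b; the product of the two candidates is -n²(b² - b + k), so q
  -- contains one of them.
  obtain ⟨c, hc, hcq⟩ : ∃ c : ℤ, (l : ℤ) ∣ c ^ 2 - c + k ∧ θ - n * c ∈ q.asIdeal := by
    have hprod : (θ - n * b) * (θ - n * ((1 - b : ℤ) : R)) ∈ q.asIdeal := by
      have e : (θ - n * b) * (θ - n * ((1 - b : ℤ) : R)) =
          (((b ^ 2 - b + k) * (- n ^ 2) : ℤ) : R) := by
        push_cast
        linear_combination h.sq_eq
      rw [e]
      exact intCast_mem_of_dvd hq (hb.mul_right _)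
    rcases q.isMaximal.isPrime.mem_or_mem hprod with hm | hm
    · exact ⟨b, hb, hm⟩
    · refine ⟨1 - b, ?_, hm⟩
      convert hb using 1
      ring
  obtain ⟨d, hd0, hdl, hd, hdq⟩ : ∃ d : ℤ, 0 ≤ d ∧ d < l ∧ (l : ℤ) ∣ d ^ 2 - d + k ∧
      θ - n * d ∈ q.asIdeal := by
    have hdiv := Int.emod_add_mul_ediv c l
    refine ⟨c % l, Int.emod_nonneg _ hlpos.ne', Int.emod_lt_of_pos _ hlpos, ?_, ?_⟩
    · have e : (c % l) ^ 2 - c % l + k =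
          c ^ 2 - c + k + l * (c / l * (1 - c - c % l)) := by
        linear_combination (c + c % l - 1) * hdiv
      rw [e]
      exact dvd_add hc (dvd_mul_right _ _)
    · have e : θ - n * ((c % l : ℤ) : R) = (θ - n * c) + (l : R) * (n * ((c / l : ℤ) : R)) := by
        have hdiv' : ((c % l : ℤ) : R) + l * ((c / l : ℤ) : R) = c := by
          exact_mod_cast congrArg (Int.cast : ℤ → R) hdiv
        linear_combination (-(n : R)) * hdiv'
      rw [e]
      exact add_mem hcq (q.asIdeal.mul_mem_right _ hq)
  set f : ℤ := d ^ 2 - d + k with hf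
  have hf0 : f ≠ 0 := by
    intro h0
    refine sq_ne_primeStar hp hp2 (2 * d - 1) ?_
    rw [hk]
    linear_combination 4 * h0
  -- From 4f = (2d - 1)² - p*, with 0 ≤ d < l and p < l. Hence f = lm with |m| < l.
  have hfabs : |f| < l * l := by
    have hpl' : (p : ℤ) + 1 ≤ l := by exact_mod_cast hpl
    have hp1 : (2 : ℤ) ≤ p := by exact_mod_cast hp.two_le
    have hkb : - (p : ℤ) ≤ 4 * k - 1 ∧ 4 * k - 1 ≤ p := by
      rcases primeStar_eq_or_eq_neg hp hp2 with h | h <;> rw [h] at hk <;> constructor <;> linarith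
    rw [abs_lt]
    constructor
    · nlinarith [sq_nonneg (2 * d - 1)]
    · nlinarith [mul_nonneg hd0 (sub_nonneg.2 (Int.add_one_le_of_lt hdl))]
  obtain ⟨m, hm⟩ := hd
  have hm0 : m ≠ 0 := by
    rintro rfl
    exact hf0 (by rw [hm, mul_zero])
  have hmabs : |m| < l := by
    rw [hm, abs_mul, Nat.abs_cast] at hfabs
    exact lt_of_mul_lt_mul_left hfabs hlpos.le
  have hlm : ¬ (l : ℤ) ∣ m := fun hdvd => by
    have := Int.le_of_dvd (abs_pos.2 hm0) ((dvd_abs _ _).2 hdvd)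
    linarith
  have hvf : padicValInt l f = 1 := by
    rw [hm, padicValInt.mul hlpos.ne' hm0, padicValInt_self, padicValInt.eq_zero_of_not_dvd hlm]
  have ha : ((-n * d : ℤ) : R) + (1 : ℤ) * θ ≠ 0 := h.add_mul_ne_zero (Or.inr one_ne_zero)
  have hb' : (n : R) + (0 : ℤ) * θ ≠ 0 := h.add_mul_ne_zero (Or.inl hn)
  have hQ := norm_ne_zero hp hp2 hk hn (Or.inr one_ne_zero : (-n * d : ℤ) ≠ 0 ∨ (1 : ℤ) ≠ 0)
  have hQ' := norm_ne_zero hp hp2 hk hn (Or.inl hn : n ≠ 0 ∨ (0 : ℤ) ≠ 0)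
  have hnorm : (-n * d) ^ 2 + n * (-n * d) * 1 + n ^ 2 * k * 1 ^ 2 = n ^ 2 * f := by
    rw [hf]
    ring
  have hnorm' : n ^ 2 + n * n * 0 + n ^ 2 * k * 0 ^ 2 = n ^ 2 := by ring
  have hval : ∀ r : ℕ, r.Prime → padicValInt r (n ^ 2 * f) =
      padicValInt r (n ^ 2) + padicValInt r f := fun r hr => by
    have := Fact.mk hr
    exact padicValInt.mul (pow_ne_zero 2 hn) hf0
  -- Away from l, either the prime below divides m and induction applies, or the norms n²f and n²
  -- have equal valuation there.
  have hother : ∀ q' : MaximalSpectrum R, (l : R) ∉ q'.asIdeal →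
      ordNat q'.asIdeal (((-n * d : ℤ) : R) + (1 : ℤ) * θ) =
        ordNat q'.asIdeal ((n : R) + (0 : ℤ) * θ) ∨
      Finsupp.single q' 1 ∈ (divHom R K).range := by
    intro q' hlq'
    obtain ⟨r, hr, hrq⟩ := h.exists_prime_mem hp hp2 hk hn q'
    by_cases hrf : (r : ℤ) ∣ f
    · right
      refine ih r ?_ hr q' hrq
      have hrl : ¬ (r : ℤ) ∣ l := fun hd =>
        hlq' ((Nat.prime_dvd_prime_iff_eq hr hl).1 (Int.natCast_dvd_natCast.1 hd) ▸ hrq)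
      rw [hm] at hrf
      have hrm := ((Nat.prime_iff_prime_int.1 hr).dvd_or_dvd hrf).resolve_left hrl
      have := Int.le_of_dvd (abs_pos.2 hm0) ((dvd_abs _ _).2 hrm)
      exact_mod_cast this.trans_lt hmabs
    · left
      refine h.ordNat_eq_ordNat hr hrq ha hb' hQ hQ' ?_ ?_
      · rw [hnorm, hnorm', hval r hr, padicValInt.eq_zero_of_not_dvd hrf, add_zero]
      · refine (h.uniqueAbove_or_split hp hp2 hk hn hr).imp id fun hs => ?_
        rw [hnorm']
        exact fun hd => hs.1 ((Nat.prime_iff_prime_int.1 hr).dvd_of_dvd_pow hd)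
  -- A conductor prime l > p can occur, coming from a denominator. Its place is unique, and residue
  -- degree times the difference of orders is 1.
  by_cases hln : (l : ℤ) ∣ n
  · have hu := h.uniqueAbove_of_dvd hl hln
    refine single_mem_range_divHom ha hb' q ?_ fun q' hq' =>
      hother q' fun hlq' => hq' (hu q' q hlq' hq)
    have h1 := h.residueVal_mul_ordNat_of_uniqueAbove hl hu hq ha hQ
    have h2 := h.residueVal_mul_ordNat_of_uniqueAbove hl hu hq hb' hQ'
    rw [hnorm, hval l hl, hvf] at h1
    rw [hnorm'] at h2
    rw [← h2] at h1
    have hres := h.residueVal_pos_of_mem hl hq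
    have hdvd : residueVal l q.asIdeal ∣ 1 :=
      (Nat.dvd_add_right (Dvd.intro _ rfl)).1 (h1 ▸ Dvd.intro _ rfl)
    rwa [Nat.dvd_one.1 hdvd, one_mul, one_mul] at h1
  · have hnq : ∀ q' : MaximalSpectrum R, (l : R) ∈ q'.asIdeal →
        ordNat q'.asIdeal ((n : R) + (0 : ℤ) * θ) = 0 := by
      intro q' hq'
      refine ordNat_eq_zero_of_notMem fun hm => hln ?_
      rw [Int.cast_zero, zero_mul, add_zero] at hm
      exact dvd_of_intCast_mem q'.isMaximal.ne_top hl hq' hm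
    have hvn : padicValInt l (n ^ 2) = 0 := padicValInt.eq_zero_of_not_dvd fun hd =>
      hln ((Nat.prime_iff_prime_int.1 hl).dvd_of_dvd_pow hd)
    -- Now n is prime to l and the total weight above l is 1, so q takes all of it.
    have hpos : 1 ≤ residueVal l q.asIdeal *
        ordNat q.asIdeal (((-n * d : ℤ) : R) + (1 : ℤ) * θ) := by
      refine Nat.mul_pos (h.residueVal_pos_of_mem hl hq) (ordNat_pos_of_mem ha ?_)
      convert hdq using 1
      push_cast
      ring
    obtain ⟨S, hS⟩ := h.exists_above hl
    have hsum := h.sum_residueVal_mul_ordNat hl S (fun q hq => (hS q).2 hq) ha hQ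
    rw [hnorm, hval l hl, hvn, hvf] at hsum
    classical
    rw [← Finset.add_sum_erase S _ ((hS q).2 hq)] at hsum
    have hq1 : residueVal l q.asIdeal *
        ordNat q.asIdeal (((-n * d : ℤ) : R) + (1 : ℤ) * θ) = 1 := by omega
    refine single_mem_range_divHom ha hb' q ?_ fun q' hq' => ?_
    · rw [hnq q hq]
      exact Nat.eq_one_of_mul_eq_one_left hq1
    · by_cases hlq' : (l : R) ∈ q'.asIdeal
      · left
        have h0 : ∑ q ∈ S.erase q, residueVal l q.asIdeal *
          ordNat q.asIdeal (((-n * d : ℤ) : R) + (1 : ℤ) * θ) = 0 := by omega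
        have := Finset.sum_eq_zero_iff.1 h0 q' (Finset.mem_erase.2 ⟨hq', (hS q').2 hlq'⟩)
        rw [hnq q' hlq']
        exact (Nat.mul_eq_zero.1 this).resolve_left (h.residueVal_pos_of_mem hl hlq').ne'
      · exact hother q' hlq'

/-- A prime `l` dividing the conductor `n` that is the norm of a fraction whose denominator is only
divisible by split primes dividing `n`. -/
theorem single_mem_of_norm {l : ℕ} (hl : l.Prime) (hln : (l : ℤ) ∣ n) {x y z t : ℤ}
    (hzt : z ≠ 0 ∨ t ≠ 0)
    (hnorm : x ^ 2 - primeStar p * y ^ 2 = l * (z ^ 2 - primeStar p * t ^ 2))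
    (hT : ∀ r : ℕ, r.Prime → r ≠ p → (∃ b : ℤ, (r : ℤ) ∣ b ^ 2 - b + k) →
      (r : ℤ) ∣ z ^ 2 - primeStar p * t ^ 2 → (r : ℤ) ∣ n)
    {q : MaximalSpectrum R} (hq : (l : R) ∈ q.asIdeal) :
    Finsupp.single q 1 ∈ (divHom R K).range := by
  have := Fact.mk hl
  have hl0 : (l : ℤ) ≠ 0 := by exact_mod_cast hl.ne_zero
  set N : ℤ := z ^ 2 - primeStar p * t ^ 2 with hN
  have hN0 : N ≠ 0 := sq_sub_primeStar_mul_sq_ne_zero hp hp2 hzt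
  have hnN : n ^ 2 * N ≠ 0 := mul_ne_zero (pow_ne_zero 2 hn) hN0
  -- Since n√p* = 2θ - n, the element n(x + y√p*) is n(x - y) + 2yθ; likewise for z and t.
  have hQa : (n * (x - y)) ^ 2 + n * (n * (x - y)) * (2 * y) + n ^ 2 * k * (2 * y) ^ 2 =
      l * (n ^ 2 * N) := by
    have : x ^ 2 - (1 - 4 * k) * y ^ 2 = l * N := by rw [← hnorm, hk]
    linear_combination n ^ 2 * this
  have hQb : (n * (z - t)) ^ 2 + n * (n * (z - t)) * (2 * t) + n ^ 2 * k * (2 * t) ^ 2 =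
      n ^ 2 * N := by
    rw [hN, hk]
    ring
  have hQ : (n * (x - y)) ^ 2 + n * (n * (x - y)) * (2 * y) + n ^ 2 * k * (2 * y) ^ 2 ≠ 0 := by
    rw [hQa]
    exact mul_ne_zero hl0 hnN
  have hQ' : (n * (z - t)) ^ 2 + n * (n * (z - t)) * (2 * t) + n ^ 2 * k * (2 * t) ^ 2 ≠ 0 := by
    rwa [hQb]
  have hne : ∀ {u v : ℤ}, u ^ 2 + n * u * v + n ^ 2 * k * v ^ 2 ≠ 0 → (u + v * θ : R) ≠ 0 := by
    intro u v huv h0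
    obtain ⟨rfl, rfl⟩ := h.eq_zero u v h0
    simp at huv
  have ha := hne hQ
  have hb := hne hQ'
  have hu := h.uniqueAbove_of_dvd hl hln
  refine single_mem_range_divHom ha hb q ?_ fun q' hq' => Or.inl ?_
  · have h1 := h.residueVal_mul_ordNat_of_uniqueAbove hl hu hq ha hQ
    have h2 := h.residueVal_mul_ordNat_of_uniqueAbove hl hu hq hb hQ'
    rw [hQa, padicValInt.mul hl0 hnN, padicValInt_self] at h1
    rw [hQb] at h2
    rw [← h2] at h1
    have hdvd : residueVal l q.asIdeal ∣ 1 :=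
      (Nat.dvd_add_left (Dvd.intro _ rfl)).1 (h1 ▸ Dvd.intro _ rfl)
    rwa [Nat.dvd_one.1 hdvd, one_mul, one_mul, add_comm 1] at h1
  · obtain ⟨r, hr, hrq⟩ := h.exists_prime_mem hp hp2 hk hn q'
    have := Fact.mk hr
    have hrl : ¬ (r : ℤ) ∣ l := by
      intro hd
      obtain rfl := (Nat.prime_dvd_prime_iff_eq hr hl).1 (Int.natCast_dvd_natCast.1 hd)
      exact hq' (hu q' q hrq hq)
    refine h.ordNat_eq_ordNat hr hrq ha hb hQ hQ' ?_ ?_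
    · rw [hQa, hQb, padicValInt.mul hl0 hnN, padicValInt.eq_zero_of_not_dvd hrl, zero_add]
    -- A split r outside the conductor cannot divide N, by the condition on denominators.
    · refine (h.uniqueAbove_or_split hp hp2 hk hn hr).imp id fun hs => ?_
      rw [hQb]
      intro hd
      rcases (Nat.prime_iff_prime_int.1 hr).dvd_or_dvd hd with hd | hd
      · exact hs.1 ((Nat.prime_iff_prime_int.1 hr).dvd_of_dvd_pow hd)
      · exact hs.1 (hT r hr hs.2.1 hs.2.2 hd)

/-- The Chow group of `ℤ[n ω]` is trivial if the conductor `n` is a product of split primes that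
contains all split primes below `p` and all split primes in the denominators of elements with norms
these primes. -/
theorem subsingleton_chowGroup
    (hnsplit : ∀ l : ℕ, l.Prime → (l : ℤ) ∣ n → l ≠ p ∧ ∃ b : ℤ, (l : ℤ) ∣ b ^ 2 - b + k)
    (hT : ∀ l : ℕ, l.Prime → l < p → (∃ b : ℤ, (l : ℤ) ∣ b ^ 2 - b + k) → (l : ℤ) ∣ n ∧
      ∃ x y z t : ℤ, (z ≠ 0 ∨ t ≠ 0) ∧
        x ^ 2 - primeStar p * y ^ 2 = l * (z ^ 2 - primeStar p * t ^ 2) ∧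
        ∀ r : ℕ, r.Prime → r ≠ p → (∃ b : ℤ, (r : ℤ) ∣ b ^ 2 - b + k) →
          (r : ℤ) ∣ z ^ 2 - primeStar p * t ^ 2 → (r : ℤ) ∣ n) :
    Subsingleton (ChowGroup R K) := by
  have key : ∀ l : ℕ, l.Prime → ∀ q : MaximalSpectrum R, (l : R) ∈ q.asIdeal →
      Finsupp.single q 1 ∈ (divHom R K).range := by
    intro l
    induction l using Nat.strong_induction_on with
    | _ l ih =>
      intro hl q hq
      by_cases hlp : l = p
      · subst hlp
        exact h.single_mem_of_ramified K hp hp2 hk hn (fun hd => (hnsplit _ hp hd).1 rfl) hq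
      by_cases hs : ∃ b : ℤ, (l : ℤ) ∣ b ^ 2 - b + k
      · rcases lt_or_gt_of_ne hlp with hlt | hlt
        · obtain ⟨hln, x, y, z, t, hzt, hnorm, hden⟩ := hT l hl hlt hs
          exact h.single_mem_of_norm K hp hp2 hk hn hl hln hzt hnorm hden hq
        · obtain ⟨b, hb⟩ := hs
          exact h.single_mem_of_split_of_lt K hp hp2 hk hn hl hlt hb hq ih
      · exact h.single_mem_of_not_split K hp hp2 hk hn hl hs (fun hd => hs (hnsplit _ hl hd).2) hq
  have htop : (divHom R K).range = ⊤ := by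
    rw [eq_top_iff]
    intro D _
    rw [← D.sum_single]
    refine sum_mem fun q _ => ?_
    obtain ⟨l, hl, hlq⟩ := h.exists_prime_mem hp hp2 hk hn q
    rw [show Finsupp.single q (D q) = D q • Finsupp.single q (1 : ℤ) by simp]
    exact AddSubgroup.zsmul_mem _ (key l hl q hlq) _
  exact QuotientAddGroup.subsingleton_iff.2 htop

end

end IsQuadraticGenerator

end OneDim

/-! ### Choice of the conductor -/

/-- There is a product of split primes that is a suitable conductor. -/
theorem exists_conductor {p : ℕ} (hp : p.Prime) (hp2 : p ≠ 2) {k : ℤ}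
    (hk : primeStar p = 1 - 4 * k) : ∃ n : ℤ, n ≠ 0 ∧
      (∀ l : ℕ, l.Prime → (l : ℤ) ∣ n → l ≠ p ∧ ∃ b : ℤ, (l : ℤ) ∣ b ^ 2 - b + k) ∧
      (∀ l : ℕ, l.Prime → l < p → (∃ b : ℤ, (l : ℤ) ∣ b ^ 2 - b + k) → (l : ℤ) ∣ n ∧
        ∃ x y z t : ℤ, (z ≠ 0 ∨ t ≠ 0) ∧
          x ^ 2 - primeStar p * y ^ 2 = l * (z ^ 2 - primeStar p * t ^ 2) ∧
          ∀ r : ℕ, r.Prime → r ≠ p → (∃ b : ℤ, (r : ℤ) ∣ b ^ 2 - b + k) →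
            (r : ℤ) ∣ z ^ 2 - primeStar p * t ^ 2 → (r : ℤ) ∣ n) := by
  classical
  have hex : ∀ l : ℕ, ∃ x y z t : ℤ,
      l.Prime → l < p → (∃ b : ℤ, (l : ℤ) ∣ b ^ 2 - b + k) → (z ≠ 0 ∨ t ≠ 0) ∧
        x ^ 2 - primeStar p * y ^ 2 = l * (z ^ 2 - primeStar p * t ^ 2) := by
    intro l
    by_cases hl : l.Prime ∧ l < p ∧ ∃ b : ℤ, (l : ℤ) ∣ b ^ 2 - b + k
    · obtain ⟨hl, hlp, b, hb⟩ := hl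
      obtain ⟨x, y, z, t, h⟩ := exists_norm_eq_prime_mul_norm hp hp2 hl hlp.ne hk hb
      exact ⟨x, y, z, t, fun _ _ _ => h⟩
    · exact ⟨0, 0, 0, 0, fun h1 h2 h3 => absurd ⟨h1, h2, h3⟩ hl⟩
  choose x y z t hxyzt using hex
  let s : Finset ℕ := (Finset.range p).filter
    fun l => l.Prime ∧ ∃ b : ℤ, (l : ℤ) ∣ b ^ 2 - b + k
  have hs : ∀ l : ℕ, l.Prime → l < p → (∃ b : ℤ, (l : ℤ) ∣ b ^ 2 - b + k) → l ∈ s :=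
    fun l hl hlp hb => Finset.mem_filter.2 ⟨Finset.mem_range.2 hlp, hl, hb⟩
  let M : ℤ := ∏ l ∈ s, (l * (z l ^ 2 - primeStar p * t l ^ 2))
  have hM0 : M ≠ 0 := by
    refine Finset.prod_ne_zero_iff.2 fun l hl => ?_
    obtain ⟨hlp, hl, hb⟩ := Finset.mem_filter.1 hl
    exact mul_ne_zero (by exact_mod_cast hl.ne_zero)
      (sq_sub_primeStar_mul_sq_ne_zero hp hp2 (hxyzt l hl (Finset.mem_range.1 hlp) hb).1)
  -- Inert primes and p are left out: there the generators l and √p* need a conductor prime to them.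
  let n : ℤ := ∏ r ∈ M.natAbs.primeFactors.filter
    (fun r => r ≠ p ∧ ∃ b : ℤ, (r : ℤ) ∣ b ^ 2 - b + k), (r : ℤ)
  have hdvd : ∀ r : ℕ, r.Prime → r ≠ p → (∃ b : ℤ, (r : ℤ) ∣ b ^ 2 - b + k) → (r : ℤ) ∣ M →
      (r : ℤ) ∣ n := by
    intro r hr hrp hb hrM
    refine Finset.dvd_prod_of_mem (fun r : ℕ => (r : ℤ)) (Finset.mem_filter.2 ⟨?_, hrp, hb⟩)
    exact Nat.mem_primeFactors.2 ⟨hr, Int.natCast_dvd.1 hrM, Int.natAbs_ne_zero.2 hM0⟩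
  refine ⟨n, ?_, ?_, ?_⟩
  · refine Finset.prod_ne_zero_iff.2 fun r hr => ?_
    exact_mod_cast (Nat.prime_of_mem_primeFactors (Finset.mem_filter.1 hr).1).ne_zero
  · intro l hl hln
    obtain ⟨r, hr, hlr⟩ := (Nat.prime_iff_prime_int.1 hl).exists_mem_finset_dvd hln
    obtain ⟨hr1, hr2⟩ := Finset.mem_filter.1 hr
    obtain rfl := (Nat.prime_dvd_prime_iff_eq hl (Nat.prime_of_mem_primeFactors hr1)).1
      (Int.natCast_dvd_natCast.1 hlr)
    exact hr2
  · intro l hl hlp hb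
    obtain ⟨h1, h2⟩ := hxyzt l hl hlp hb
    have hfac := Finset.dvd_prod_of_mem
      (fun l : ℕ => (l : ℤ) * (z l ^ 2 - primeStar p * t l ^ 2)) (hs l hl hlp hb)
    exact ⟨hdvd l hl hlp.ne hb ((dvd_mul_right _ _).trans hfac), x l, y l, z l, t l, h1, h2,
      fun r hr hrp hrb hrd => hdvd r hr hrp hrb ((hrd.mul_left _).trans hfac)⟩

/-! ### Quadratic fields, their orders and isomorphisms -/

section

variable {K : Type*} [Field K] [CharZero K]

/-- A field containing `ℚ` with `ℚ`-basis `1, δ`, where `δ ^ 2 = d`. -/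
structure IsQuadraticRoot (δ : K) (d : ℤ) : Prop where
  sq_eq : δ ^ 2 = d
  exists_eq (x : K) : ∃ a b : ℚ, x = a + b * δ
  not_rat (a : ℚ) : (a : K) ≠ δ

namespace IsQuadraticRoot

variable {δ : K} {d : ℤ} (h : IsQuadraticRoot δ d)

include h

theorem eq_zero {a b : ℚ} (hab : (a + b * δ : K) = 0) : a = 0 ∧ b = 0 := by
  have hb : b = 0 := by
    by_contra hb
    have hb' : (b : K) ≠ 0 := Rat.cast_ne_zero.2 hb
    refine h.not_rat (-a / b) ?_
    push_cast
    rw [div_eq_iff hb']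
    linear_combination -hab
  subst hb
  exact ⟨by simpa using hab, rfl⟩

theorem finrank_eq_two : Module.finrank ℚ K = 2 := by
  have hli : LinearIndependent ℚ ![(1 : K), δ] := by
    rw [LinearIndependent.pair_iff]
    intro s t hst
    exact h.eq_zero (by simpa [Rat.smul_def] using hst)
  have hspan : ⊤ ≤ Submodule.span ℚ (Set.range ![(1 : K), δ]) := by
    intro r _
    obtain ⟨u, v, rfl⟩ := h.exists_eq r
    have h1 : (1 : K) ∈ Submodule.span ℚ (Set.range ![(1 : K), δ]) :=
      Submodule.subset_span ⟨0, rfl⟩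
    have h2 : δ ∈ Submodule.span ℚ (Set.range ![(1 : K), δ]) := Submodule.subset_span ⟨1, rfl⟩
    simpa [Rat.smul_def] using
      add_mem (Submodule.smul_mem _ u h1) (Submodule.smul_mem _ v h2)
  rw [Module.finrank_eq_card_basis (Module.Basis.mk hli hspan), Fintype.card_fin]

theorem exists_order {n k : ℤ} (hn : n ≠ 0) (hk : d = 1 - 4 * k) :
    ∃ (O : NumberFieldOrder K) (θ : O.toSubring), OneDim.IsQuadraticGenerator θ n k := by
  -- This local `ω` is already multiplied by the conductor.
  let ω : K := n * (1 + δ) / 2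
  have hω : ω ^ 2 = n * ω - n ^ 2 * k := by
    have hd := h.sq_eq
    rw [hk] at hd
    push_cast at hd
    simp only [ω]
    linear_combination (n : K) ^ 2 / 4 * hd
  have hn' : (n : K) ≠ 0 := Int.cast_ne_zero.2 hn
  let S : Subring K :=
    { carrier := {x | ∃ u v : ℤ, x = u + v * ω}
      zero_mem' := ⟨0, 0, by simp⟩
      one_mem' := ⟨1, 0, by simp⟩
      add_mem' := by
        rintro _ _ ⟨u, v, rfl⟩ ⟨s, t, rfl⟩
        exact ⟨u + s, v + t, by push_cast; ring⟩
      neg_mem' := by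
        rintro _ ⟨u, v, rfl⟩
        exact ⟨-u, -v, by push_cast; ring⟩
      mul_mem' := by
        rintro _ _ ⟨u, v, rfl⟩ ⟨s, t, rfl⟩
        refine ⟨u * s - n ^ 2 * k * v * t, u * t + v * s + n * v * t, ?_⟩
        push_cast
        linear_combination (v * t : K) * hω }
  have hωS : ω ∈ S := ⟨0, 1, by simp⟩
  have hfin : Module.Finite ℤ S := by
    classical
    refine ⟨⟨{1, ⟨ω, hωS⟩}, ?_⟩⟩
    rw [eq_top_iff]
    rintro ⟨_, u, v, rfl⟩ _
    rw [Finset.coe_insert, Finset.coe_singleton, Submodule.mem_span_pair]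
    refine ⟨u, v, Subtype.ext ?_⟩
    simp
  have hδ : δ = (2 / n : ℚ) • ω - (1 : K) := by
    rw [Rat.smul_def]
    push_cast
    simp only [ω]
    field_simp
    ring
  have hspan : Submodule.span ℚ (S : Set K) = ⊤ := by
    rw [eq_top_iff]
    intro x _
    obtain ⟨a, b, rfl⟩ := h.exists_eq x
    have h1 : (1 : K) ∈ Submodule.span ℚ (S : Set K) := Submodule.subset_span (one_mem S)
    have h2 : δ ∈ Submodule.span ℚ (S : Set K) := by
      rw [hδ]
      exact sub_mem (Submodule.smul_mem _ _ (Submodule.subset_span hωS)) h1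
    simpa [Rat.smul_def] using
      add_mem (Submodule.smul_mem _ a h1) (Submodule.smul_mem _ b h2)
  refine ⟨⟨S, hfin, hspan⟩, ⟨ω, hωS⟩, ?_, ?_, ?_⟩
  · exact Subtype.ext (by simpa using hω)
  · rintro ⟨_, u, v, rfl⟩
    exact ⟨u, v, Subtype.ext (by simp)⟩
  · intro u v huv
    have huv' : (u + v * ω : K) = 0 := by simpa using congrArg Subtype.val huv
    have := h.eq_zero (a := u + v * n / 2) (b := v * n / 2) (by
      push_cast
      rw [← huv']
      simp only [ω]
      ring)
    have hv : v = 0 := by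
      have hvn : (v * n : ℚ) = 0 := by linarith [this.2]
      exact (mul_eq_zero.1 (by exact_mod_cast hvn : v * n = 0)).resolve_right hn
    subst hv
    exact ⟨by simpa using this.1, rfl⟩

/-- The squares of elements of `ℚ(√d)` that are rational. -/
theorem isSquare_or_isSquare_mul (y : K) (c : ℤ) (hy : y ^ 2 = c) :
    IsSquare c ∨ IsSquare (c * d) := by
  obtain ⟨a, b, rfl⟩ := h.exists_eq y
  have key := h.eq_zero (a := a ^ 2 + b ^ 2 * d - c) (b := 2 * a * b) (by
    push_cast
    linear_combination hy - (b : K) ^ 2 * h.sq_eq)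
  -- If a = 0 then c = b²d, so cd = (bd)²; if b = 0 then c = a².
  have hab : a * b = 0 := by linarith [key.2]
  rcases mul_eq_zero.1 hab with rfl | rfl
  · right
    rw [← Rat.isSquare_intCast_iff]
    refine ⟨b * d, ?_⟩
    push_cast
    linear_combination -(d : ℚ) * key.1
  · left
    rw [← Rat.isSquare_intCast_iff]
    exact ⟨a, by linear_combination -key.1⟩

end IsQuadraticRoot

end

theorem exists_isQuadraticRoot_sqrtField {d : ℤ} (hd : ¬ IsSquare d) :
    ∃ δ : sqrtField d, IsQuadraticRoot δ d := by
  obtain ⟨α, hα⟩ := IsAlgClosed.exists_pow_nat_eq (d : ℂ) two_pos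
  have hmem : α ∈ sqrtField d := IntermediateField.subset_adjoin ℚ _ hα
  have hint : IsIntegral ℚ α :=
    ⟨Polynomial.X ^ 2 - Polynomial.C (d : ℚ), Polynomial.monic_X_pow_sub_C _ two_ne_zero,
      by
      rw [Polynomial.eval₂_sub, Polynomial.eval₂_pow, Polynomial.eval₂_X, Polynomial.eval₂_C, hα]
      simp⟩
  have heq : sqrtField d = IntermediateField.adjoin ℚ {α} := by
    refine le_antisymm (IntermediateField.adjoin_le_iff.2 fun β hβ => ?_)
      (IntermediateField.adjoin_le_iff.2 (by simpa using hmem))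
    have hα' := IntermediateField.mem_adjoin_simple_self ℚ α
    rcases sq_eq_sq_iff_eq_or_eq_neg.1 ((show β ^ 2 = d from hβ).trans hα.symm) with rfl | rfl
    · exact hα'
    · exact neg_mem hα'
  refine ⟨⟨α, hmem⟩, Subtype.ext (by simpa using hα), ?_, ?_⟩
  · rintro ⟨x, hx⟩
    suffices ∃ a b : ℚ, x = a + b * α by
      obtain ⟨a, b, rfl⟩ := this
      exact ⟨a, b, Subtype.ext (by simp)⟩
    rw [heq, ← IntermediateField.mem_toSubalgebra,
      IntermediateField.adjoin_simple_toSubalgebra_of_isAlgebraic hint.isAlgebraic] at hx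
    induction hx using Algebra.adjoin_induction with
    | mem x hx => exact ⟨0, 1, by simpa using hx⟩
    | algebraMap r => exact ⟨r, 0, by simp⟩
    | add x y _ _ hx hy =>
      obtain ⟨a, b, rfl⟩ := hx
      obtain ⟨a', b', rfl⟩ := hy
      exact ⟨a + a', b + b', by push_cast; ring⟩
    | mul x y _ _ hx hy =>
      obtain ⟨a, b, rfl⟩ := hx
      obtain ⟨a', b', rfl⟩ := hy
      refine ⟨a * a' + b * b' * d, a * b' + a' * b, ?_⟩
      push_cast
      linear_combination (b * b' : ℂ) * hα
  · intro a ha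
    have ha' : (a : ℂ) = α := by simpa using congrArg Subtype.val ha
    apply hd
    rw [← Rat.isSquare_intCast_iff]
    refine ⟨a, ?_⟩
    rw [← ha'] at hα
    have : (a ^ 2 : ℚ) = d := by exact_mod_cast hα
    rw [← this, sq]

theorem not_isSquare_primeStar {p : ℕ} (hp : p.Prime) (hp2 : p ≠ 2) :
    ¬ IsSquare (primeStar p) := by
  rintro ⟨r, hr⟩
  exact sq_ne_primeStar hp hp2 r (by rw [hr, sq])

theorem not_isSquare_primeStar_mul {p q : ℕ} (hp : p.Prime) (hp2 : p ≠ 2) (hq : q.Prime)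
    (hq2 : q ≠ 2) (hpq : p ≠ q) : ¬ IsSquare (primeStar p * primeStar q) := by
  rintro ⟨r, hr⟩
  have habs : ∀ {p : ℕ}, p.Prime → p ≠ 2 → (primeStar p).natAbs = p := fun hp hp2 => by
    rcases primeStar_eq_or_eq_neg hp hp2 with h | h <;> rw [h] <;> simp
  have h1 := congrArg Int.natAbs hr
  rw [Int.natAbs_mul, Int.natAbs_mul, habs hp hp2, habs hq hq2] at h1
  have hpr : p ∣ r.natAbs := or_self_iff.1 (hp.dvd_mul.1 ⟨q, h1.symm⟩)
  obtain ⟨s, hs⟩ := hpr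
  rw [hs, mul_assoc] at h1
  have h2 := Nat.eq_of_mul_eq_mul_left hp.pos h1
  refine hpq ((Nat.prime_dvd_prime_iff_eq hp hq).1 ⟨s * s, ?_⟩)
  rw [h2]
  ring

theorem finrank_sqrtField_primeStar {p : ℕ} (hp : p.Prime) (hp2 : p ≠ 2) :
    Module.finrank ℚ (sqrtField (primeStar p)) = 2 := by
  obtain ⟨δ, hδ⟩ := exists_isQuadraticRoot_sqrtField (not_isSquare_primeStar hp hp2)
  exact hδ.finrank_eq_two

theorem exists_order_subsingleton_chowGroup {p : ℕ} (hp : p.Prime) (hp2 : p ≠ 2) :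
    ∃ O : NumberFieldOrder (sqrtField (primeStar p)), Subsingleton O.ChowGroup := by
  obtain ⟨δ, hδ⟩ := exists_isQuadraticRoot_sqrtField (not_isSquare_primeStar hp hp2)
  obtain ⟨k, hk⟩ := exists_one_sub_primeStar hp hp2
  obtain ⟨n, hn, hn1, hn2⟩ := exists_conductor hp hp2 hk
  obtain ⟨O, θ, hθ⟩ := hδ.exists_order hn hk
  exact ⟨O, hθ.subsingleton_chowGroup _ hp hp2 hk hn hn1 hn2⟩

/-- An isomorphism would give p* a square root in ℚ(√q*), making p* or p*q* a square in ℤ. -/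
theorem isEmpty_sqrtField_ringEquiv {p q : ℕ} (hp : p.Prime) (hp2 : p ≠ 2) (hq : q.Prime)
    (hq2 : q ≠ 2) (hpq : p ≠ q) :
    IsEmpty (sqrtField (primeStar p) ≃+* sqrtField (primeStar q)) := by
  refine ⟨fun e => ?_⟩
  obtain ⟨δ, hδ⟩ := exists_isQuadraticRoot_sqrtField (not_isSquare_primeStar hp hp2)
  obtain ⟨ε, hε⟩ := exists_isQuadraticRoot_sqrtField (not_isSquare_primeStar hq hq2)
  have hy : (e δ) ^ 2 = (primeStar p : ℤ) := by rw [← map_pow, hδ.sq_eq, map_intCast]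
  rcases hε.isSquare_or_isSquare_mul (e δ) _ hy with h | h
  · exact not_isSquare_primeStar hp hp2 h
  · exact not_isSquare_primeStar_mul hp hp2 hq hq2 hpq h

theorem theorem3p8 :
    (∀ p : ℕ, p.Prime → p ≠ 2 →
      Module.finrank ℚ (sqrtField (primeStar p)) = 2 ∧
      ∃ O : NumberFieldOrder (sqrtField (primeStar p)), Subsingleton O.ChowGroup) ∧
    (∀ p q : ℕ, p.Prime → p ≠ 2 → q.Prime → q ≠ 2 → p ≠ q →
      IsEmpty (sqrtField (primeStar p) ≃+* sqrtField (primeStar q))) ∧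
    (∃ S : Set (IntermediateField ℚ ℂ), S.Infinite ∧
      S.Pairwise (fun E F => IsEmpty (E ≃+* F)) ∧
      ∀ F ∈ S, Module.finrank ℚ F = 2 ∧
        ∃ O : NumberFieldOrder F, Subsingleton O.ChowGroup) := by
  refine ⟨fun p hp hp2 => ⟨finrank_sqrtField_primeStar hp hp2,
    exists_order_subsingleton_chowGroup hp hp2⟩,
    fun p q hp hp2 hq hq2 hpq => isEmpty_sqrtField_ringEquiv hp hp2 hq hq2 hpq,
    (fun p : ℕ => sqrtField (primeStar p)) '' ({p : ℕ | p.Prime} \ {2}), ?_, ?_, ?_⟩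
  · refine (Nat.infinite_setOfPred_prime.sdiff (Set.finite_singleton 2)).image ?_
    rintro p ⟨hp, hp2⟩ q ⟨hq, hq2⟩ heq
    by_contra hpq
    have heq' : sqrtField (primeStar p) = sqrtField (primeStar q) := heq
    have hempty := isEmpty_sqrtField_ringEquiv hp hp2 hq hq2 hpq
    rw [heq'] at hempty
    exact hempty.false (RingEquiv.refl _)
  · rintro _ ⟨p, ⟨hp, hp2⟩, rfl⟩ _ ⟨q, ⟨hq, hq2⟩, rfl⟩ hne
    refine isEmpty_sqrtField_ringEquiv hp hp2 hq hq2 ?_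
    rintro rfl
    exact hne rfl
  · rintro _ ⟨p, ⟨hp, hp2⟩, rfl⟩
    exact ⟨finrank_sqrtField_primeStar hp hp2, exists_order_subsingleton_chowGroup hp hp2⟩
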